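/- Let $(X,d,m)$ be an Ahlfors $N$-regular metric measure space with $N>0$ and $m(X)=\infty$: open sets are measurable and there are constants $0<c\le C$ with $c\,r^N\le m(B(x,r))\le C\,r^N$ for all $x\in X$, $r>0$. Let $h:[0,\infty)\to\mathbb R$ be a nonnegative nonincreasing $C^\infty$ function with $h\equiv1$ on $[0,1/2]$ and $h\equiv0$ on $[2,\infty)$. For $t>0$ put $$T_tf(x)=\frac1{t^N}\int_X h\Big(\frac{d(x,y)}t\Big)f(y)\,dm(y),\qquad \varphi(x,t)=\frac1{T_t1(x)},\qquad \psi(x,t)=\frac1{T_t(1/T_t1)(x)},$$ $$s(x,y,t)=\frac{\varphi(x,t)\varphi(y,t)}{t^{2N}}\int_X h\Big(\frac{d(x,z)}t\Big)h\Big(\frac{d(y,z)}t\Big)\psi(z,t)\,dm(z),$$ and for $\alpha>0$ let $$k_\alpha(x,y)=\alpha\int_0^\infty\frac{t^\alpha}{(1+t^\alpha)^2}\,s(x,y,t)\,\frac{dt}t,\qquad J_\alpha g(x)=\int_X g(z)\,k_\alpha(x,z)\,dm(z).$$ The potential space is $L^{\alpha,p}=J_\alpha(L^p)$ with norm $\|f\|_{\alpha,p}=\|f\|_p+\inf\{\|g\|_p: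 g\in L^p,\ J_\alpha g=f\}$. Functions are real-valued and identified when they agree almost everywhere. $BMO$ is the space of functions $f$ integrable on balls with $\|f\|_{BMO}=\sup_B\frac1{m(B)}\int_B|f-f_B|\,dm<\infty$, where $B$ runs over all balls and $f_B=\frac1{m(B)}\int_Bf\,dm$; $C^\beta$ is the space of bounded functions $u$ with $|u(x)-u(y)|\le A\,d(x,y)^\beta$ for some $A$ and all $x,y$, with norm $\sup|u|+[u]_\beta$, where $[u]_\beta$ is the least such $A$. Finally, $A\hookrightarrow B$ means that $A\subset B$ and $\|f\|_B\le C\|f\|_A$ for all $f\in A$, with $C$ independent of $f$. **Theorem.** Let $1<p<\infty$ and $\alpha>0$. (a) If $p<N/\alpha$, then $L^{\alpha,p}\hookrightarrow L^q$ for $p\le q\le p^*$, where $\frac1{p^*}=\frac1p-\frac\alpha N$. (b) If $p=N/\alpha$, then $L^{\alpha,p}\hookrightarrow L^q$ for $p\le q<\infty$. If in addition $\alpha<1$, then $L^{\alpha,p}\hookrightarrow BMO$. (c) If $p>N/\alpha$, then $L^{\alpha,p}\hookrightarrow L^q$ for $p\le q\le\infty$. If in addition $\alpha<1+N/p$, then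 $L^{\alpha,p}\hookrightarrow C^{\alpha-N/p}$. -/

import Mathlib

open MeasureTheory Set
open scoped ENNReal NNReal ContDiff

namespace AhlforsBessel

/-- `(X, d, μ)` is Ahlfors `N`-regular: `μ (B(x, r))` is comparable to `r ^ N`, uniformly in
`x ∈ X` and `0 < r < μ X`. -/
structure IsAhlforsRegular {X : Type*} [MetricSpace X] [MeasurableSpace X]
    (μ : Measure X) (N : ℝ) : Prop where
  dim_pos : 0 < N
  measure_ball : ∃ c C : ℝ, 0 < c ∧ 0 < C ∧ ∀ (x : X) (r : ℝ), 0 < r →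
    ENNReal.ofReal r < μ univ →
      ENNReal.ofReal (c * r ^ N) ≤ μ (Metric.ball x r) ∧
      μ (Metric.ball x r) ≤ ENNReal.ofReal (C * r ^ N)

/-- The profile `h : [0, ∞) → ℝ`: nonnegative, nonincreasing, `C^∞`, equal to `1` on `[0, 1/2]`
and to `0` on `[2, ∞)`. Values at negative numbers play no role. -/
structure IsCutoff (h : ℝ → ℝ) : Prop where
  nonneg : ∀ r, 0 ≤ r → 0 ≤ h r
  antitone : AntitoneOn h (Ici 0)
  smooth : ContDiffOn ℝ ∞ h (Ici 0)
  eq_one : ∀ r, 0 ≤ r → r ≤ 1 / 2 → h r = 1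
  eq_zero : ∀ r, 2 ≤ r → h r = 0

section Kernels

variable {X : Type*} [MetricSpace X] [MeasurableSpace X]

/-- `T_t f (x) = t^{-N} ∫ h(d(x,y)/t) f(y) dμ(y)`. -/
noncomputable def opT (μ : Measure X) (N : ℝ) (h : ℝ → ℝ) (t : ℝ) (f : X → ℝ) (x : X) : ℝ :=
  1 / t ^ N * ∫ y, h (dist x y / t) * f y ∂μ

/-- `φ(x,t) = 1 / T_t 1 (x)`. -/
noncomputable def phi (μ : Measure X) (N : ℝ) (h : ℝ → ℝ) (x : X) (t : ℝ) : ℝ :=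
  1 / opT μ N h t (fun _ => 1) x

/-- `ψ(x,t) = 1 / T_t (1 / T_t 1) (x)`. -/
noncomputable def psi (μ : Measure X) (N : ℝ) (h : ℝ → ℝ) (x : X) (t : ℝ) : ℝ :=
  1 / opT μ N h t (fun y => 1 / opT μ N h t (fun _ => 1) y) x

/-- The kernel `s(x,y,t)` of the Coifman-type approximation of the identity
`S_t = M_t T_t V_t T_t M_t`, where `M_t`, `V_t` are multiplication by `φ(·,t)`, `ψ(·,t)`. -/
noncomputable def kernelS (μ : Measure X) (N : ℝ) (h : ℝ → ℝ) (x y : X) (t : ℝ) : ℝ :=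
  phi μ N h x t * phi μ N h y t / t ^ (2 * N) *
    ∫ z, h (dist x z / t) * h (dist y z / t) * psi μ N h z t ∂μ

/-- The Bessel kernel `k_α(x,y) = α ∫_0^∞ t^α / (1 + t^α)^2 s(x,y,t) dt/t`.
(On the diagonal, a null set in an Ahlfors regular space, the integral may diverge.) -/
noncomputable def besselKernel (μ : Measure X) (N : ℝ) (h : ℝ → ℝ) (α : ℝ) (x y : X) : ℝ :=
  α * ∫ t in Ioi (0 : ℝ), t ^ α / (1 + t ^ α) ^ 2 * kernelS μ N h x y t / t

/-- The Bessel potential `J_α g (x) = ∫ g(z) k_α(x,z) dμ(z)`. -/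
noncomputable def besselPotential (μ : Measure X) (N : ℝ) (h : ℝ → ℝ) (α : ℝ)
    (g : X → ℝ) (x : X) : ℝ :=
  ∫ z, g z * besselKernel μ N h α x z ∂μ

end Kernels

/-- A space of real functions on `X`: which functions belong to it, and their (semi)norm.
In all the spaces below both depend only on the almost everywhere class of the function. -/
structure FunctionSpace (X : Type*) where
  mem : (X → ℝ) → Prop
  norm : (X → ℝ) → ℝ≥0∞

/-- `A ↪ B`: `A` is contained in `B` and the (linear) inclusion is bounded. -/
def FunctionSpace.Embeds {X : Type*} (A B : FunctionSpace X) : Prop :=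
  ∃ C : ℝ≥0, ∀ f : X → ℝ, A.mem f → B.mem f ∧ B.norm f ≤ C * A.norm f

section Spaces

variable {X : Type*} [MetricSpace X] [MeasurableSpace X]

/-- The Lebesgue space `L^q`. -/
noncomputable def lebesgueSpace (μ : Measure X) (q : ℝ≥0∞) : FunctionSpace X where
  mem f := MemLp f q μ
  norm f := eLpNorm f q μ

/-- The potential space `L^{α,p} = J_α (L^p)`, with norm
`‖f‖_p + inf {‖g‖_p : g ∈ L^p, J_α g = f}`. -/
noncomputable def potentialSpace (μ : Measure X) (N : ℝ) (h : ℝ → ℝ) (α : ℝ) (p : ℝ≥0∞) :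
    FunctionSpace X where
  mem f := MemLp f p μ ∧ ∃ g : X → ℝ, MemLp g p μ ∧ f =ᵐ[μ] besselPotential μ N h α g
  norm f := eLpNorm f p μ +
    ⨅ (g : X → ℝ) (_ : MemLp g p μ ∧ f =ᵐ[μ] besselPotential μ N h α g), eLpNorm g p μ

/-- `sup_B ⨍_B |f - f_B| dμ`, the supremum being over all balls `B`. -/
noncomputable def bmoSeminorm (μ : Measure X) (f : X → ℝ) : ℝ≥0∞ :=
  ⨆ (x : X) (r : ℝ) (_ : 0 < r),
    ⨍⁻ y in Metric.ball x r, ‖f y - ⨍ z in Metric.ball x r, f z ∂μ‖ₑ ∂μ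

/-- The space `BMO` of functions of bounded mean oscillation, with its usual seminorm
(which vanishes on constants). -/
noncomputable def bmoSpace (μ : Measure X) : FunctionSpace X where
  mem f := (∀ (x : X) (r : ℝ), 0 < r → IntegrableOn f (Metric.ball x r) μ) ∧ bmoSeminorm μ f < ⊤
  norm f := bmoSeminorm μ f

/-- The space `C^β` of bounded Lipschitz-`β` (Hölder) functions with norm `sup |u| + [u]_β`,
as a space of almost everywhere classes. -/
noncomputable def holderSpace (μ : Measure X) (β : ℝ≥0) : FunctionSpace X where
  mem f := ∃ u : X → ℝ, f =ᵐ[μ] u ∧ (⨆ x, ‖u x‖ₑ) < ⊤ ∧ MemHolder β u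
  norm f := ⨅ (u : X → ℝ) (_ : f =ᵐ[μ] u), (⨆ x, ‖u x‖ₑ) + eHolderNorm β u

end Spaces

end AhlforsBessel

/-!
A space of infinite measure is regular at all radii, so the kernel `s(x, z, t)` is bounded by a
multiple of `t ^ (-N)`, vanishes for `d(x, z) ≥ 4t`, and is Lipschitz in `x` at scale `t`. Hence
`|J_α g (x)|` is at most a multiple of `∫ w(t) A_{4t}|g|(x) dt`, where `A_r` is the average over
`B(x, r)` and `w(t) = α t^α / (1 + t^α)^2 / t` is at most `α t^(β - 1)` for every `0 ≤ β ≤ α`.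
By Hölder's inequality `A_r|g| ≤ C r^(-N/p) ‖g‖_p`.

For the embedding into `L^q` take `β = N (1/p - 1/q)`, bound the averages by the maximal function of
`g` at the scales below some `r` and by Hölder above it, and optimise in `r`: this is Hedberg's
inequality, and the maximal theorem finishes the proof. If `N/p < α`, Hölder's bound is integrable
over all scales, which gives `L^∞`.

In a difference `J_α g (x) - J_α g (x')`, the scales `t` above `d(x, x')` gain the factor
`d(x, x') / t` and those below it are estimated by size. For `N/p < α` this gives Hölder
continuity; for `α = N/p` the small scales are bounded only on average over a ball, which gives
`BMO`.
-/

namespace AhlforsBessel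

section Growth

/-- Upper `N`-dimensional growth of a measure at all radii, with constant `C`. Together with
`LowerGrowth` it is Ahlfors regularity of a space of infinite measure. -/
structure UpperGrowth {X : Type*} [PseudoMetricSpace X] [MeasurableSpace X]
    (μ : Measure X) (N : ℝ) (C : ℝ≥0) : Prop where
  const_pos : 0 < C
  measure_ball_le : ∀ (x : X) (r : ℝ), 0 < r → μ (Metric.ball x r) ≤ C * ENNReal.ofReal (r ^ N)

/-- Lower `N`-dimensional growth of a measure at all radii, with constant `c`. -/
structure LowerGrowth {X : Type*} [PseudoMetricSpace X] [MeasurableSpace X]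
    (μ : Measure X) (N : ℝ) (c : ℝ≥0) : Prop where
  const_pos : 0 < c
  le_measure_ball : ∀ (x : X) (r : ℝ), 0 < r → c * ENNReal.ofReal (r ^ N) ≤ μ (Metric.ball x r)

theorem IsAhlforsRegular.exists_growth {X : Type*} [MetricSpace X] [MeasurableSpace X]
    {μ : Measure X} {N : ℝ} (hreg : IsAhlforsRegular μ N) (hμ : μ univ = ⊤) :
    ∃ c C : ℝ≥0, LowerGrowth μ N c ∧ UpperGrowth μ N C := by
  obtain ⟨-, c, C, hc, hC, hball⟩ := hreg
  have htop (r : ℝ) : ENNReal.ofReal r < μ univ := by simp [hμ]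
  refine ⟨c.toNNReal, C.toNNReal, ⟨Real.toNNReal_pos.2 hc, fun x r hr => ?_⟩,
    ⟨Real.toNNReal_pos.2 hC, fun x r hr => ?_⟩⟩
  · exact (ENNReal.ofReal_mul hc.le).symm.trans_le (hball x r hr (htop r)).1
  · exact (hball x r hr (htop r)).2.trans_eq (ENNReal.ofReal_mul hC.le)

variable {X : Type*} [PseudoMetricSpace X] [MeasurableSpace X] {μ : Measure X} {N r : ℝ}
  {c C : ℝ≥0}

namespace UpperGrowth

theorem measure_ball_lt_top (hC : UpperGrowth μ N C) (x : X) (r : ℝ) :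
    μ (Metric.ball x r) < ⊤ := by
  rcases le_or_gt r 0 with hr | hr
  · simp [Metric.ball_eq_empty.2 hr]
  · exact (hC.measure_ball_le x r hr).trans_lt (ENNReal.mul_lt_top (by simp) (by simp))

theorem measureReal_ball_le (hC : UpperGrowth μ N C) (x : X) (hr : 0 < r) :
    μ.real (Metric.ball x r) ≤ C * r ^ N := by
  refine ENNReal.toReal_le_of_le_ofReal (by positivity) ((hC.measure_ball_le x r hr).trans_eq ?_)
  rw [ENNReal.ofReal_mul C.coe_nonneg, ENNReal.ofReal_coe_nnreal]

theorem sigmaFinite (hC : UpperGrowth μ N C) : SigmaFinite μ := by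
  rcases isEmpty_or_nonempty X with _ | ⟨⟨x⟩⟩
  · rw [Measure.eq_zero_of_isEmpty μ]
    infer_instance
  · exact ⟨⟨{ set := fun n => Metric.ball x n
              set_mem := fun _ => trivial
              finite := fun n => hC.measure_ball_lt_top x n
              spanning := Metric.iUnion_ball_nat x }⟩⟩

end UpperGrowth

namespace LowerGrowth

theorem le_measureReal_ball (hc : LowerGrowth μ N c) {x : X} (hr : 0 < r)
    (hfin : μ (Metric.ball x r) ≠ ⊤) : c * r ^ N ≤ μ.real (Metric.ball x r) := by
  refine (ENNReal.ofReal_le_iff_le_toReal hfin).1 (le_trans (le_of_eq ?_)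
    (hc.le_measure_ball x r hr))
  rw [ENNReal.ofReal_mul c.coe_nonneg, ENNReal.ofReal_coe_nnreal]

theorem isOpenPosMeasure (hc : LowerGrowth μ N c) : μ.IsOpenPosMeasure where
  open_pos U hU := by
    rintro ⟨x, hx⟩
    obtain ⟨r, hr, hball⟩ := Metric.isOpen_iff.1 hU x hx
    have hpos : 0 < c * ENNReal.ofReal (r ^ N) :=
      ENNReal.mul_pos (by simpa using hc.const_pos.ne') (by simpa using Real.rpow_pos_of_pos hr N)
    exact (hpos.trans_le ((hc.le_measure_ball x r hr).trans (measure_mono hball))).ne'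

end LowerGrowth

variable [OpensMeasurableSpace X]

theorem exists_countable_disjoint_ball_covering (μ : Measure X) [SFinite μ] {s : Set X}
    {r : X → ℝ} {R : ℝ} (hr : ∀ x ∈ s, 0 < r x) (hR : ∀ x ∈ s, r x ≤ R)
    (hpos : ∀ x ∈ s, 0 < μ (Metric.ball x (r x))) :
    ∃ u ⊆ s, u.Countable ∧ (u.PairwiseDisjoint fun x => Metric.ball x (r x)) ∧
      s ⊆ ⋃ x ∈ u, Metric.ball x (6 * r x) := by
  obtain ⟨u, hus, hdisj, hcover⟩ := Vitali.exists_disjoint_subfamily_covering_enlargement_closedBall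
    s id r R hR 5 (by norm_num)
  have hdisj' : u.PairwiseDisjoint fun x => Metric.ball x (r x) :=
    hdisj.mono fun _ => Metric.ball_subset_closedBall
  refine ⟨u, hus, ?_, hdisj', fun x hx => ?_⟩
  · have huniv : {x : u | 0 < μ (Metric.ball (x : X) (r x))} = univ :=
      eq_univ_of_forall fun x => hpos x (hus x.2)
    rw [← countable_coe_iff, ← countable_univ_iff, ← huniv]
    exact Measure.countable_meas_pos_of_disjoint_iUnion
      (fun _ => Metric.isOpen_ball.measurableSet)
      fun x y hxy => hdisj' x.2 y.2 (Subtype.coe_injective.ne hxy)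
  · obtain ⟨y, hy, hsub⟩ := hcover x hx
    refine mem_biUnion hy (Metric.closedBall_subset_ball ?_
      (hsub (Metric.mem_closedBall_self (hr x hx).le)))
    linarith [hr y (hus hy)]

theorem secondCountableTopology_of_isOpenPosMeasure (μ : Measure X) [SFinite μ]
    [μ.IsOpenPosMeasure] : SecondCountableTopology X := by
  refine Metric.secondCountable_of_almost_dense_set fun ε hε => ?_
  have hε6 : 0 < ε / 6 := by positivity
  obtain ⟨u, -, hu, -, hcover⟩ := exists_countable_disjoint_ball_covering μ (s := univ)
    (r := fun _ => ε / 6) (fun _ _ => hε6) (fun _ _ => le_rfl)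
    (fun x _ => Metric.measure_ball_pos μ x hε6)
  refine ⟨u, hu, fun x => ?_⟩
  obtain ⟨y, hy, hxy⟩ := mem_iUnion₂.1 (hcover (mem_univ x))
  rw [Metric.mem_ball, mul_div_cancel₀ _ (by norm_num)] at hxy
  exact ⟨y, hy, hxy.le⟩

end Growth

section Cutoff

/-- Lipschitz profiles on `[0, ∞)` equal to `1` on `[0, 1/2]` and to `0` on `[2, ∞)`: what the
kernel estimates need of the profile of `IsCutoff`. -/
structure IsLipschitzCutoff (h : ℝ → ℝ) (L : ℝ≥0) : Prop where
  nonneg : ∀ r, 0 ≤ r → 0 ≤ h r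
  le_one : ∀ r, 0 ≤ r → h r ≤ 1
  eq_one : ∀ r, 0 ≤ r → r ≤ 1 / 2 → h r = 1
  eq_zero : ∀ r, 2 ≤ r → h r = 0
  lipschitz : LipschitzOnWith L h (Ici 0)

variable {h : ℝ → ℝ} {L : ℝ≥0}

theorem IsCutoff.exists_isLipschitzCutoff (hh : IsCutoff h) : ∃ L, IsLipschitzCutoff h L := by
  obtain ⟨L, hL⟩ : ∃ L, LipschitzOnWith L h (Icc 0 2) :=
    ((hh.smooth.of_le (by exact_mod_cast le_top)).mono Icc_subset_Ici_self).exists_lipschitzOnWith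
      (n := 1) one_ne_zero (convex_Icc 0 2) isCompact_Icc
  let clamp : ℝ → Icc (0 : ℝ) 2 := projIcc 0 2 zero_le_two
  have hclamp : EqOn h (fun r => h (clamp r)) (Ici 0) := fun r hr => by
    rcases le_total r 2 with h2 | h2
    · simp only [clamp, projIcc_of_mem _ (mem_Icc.2 ⟨hr, h2⟩)]
    · simp only [clamp, projIcc_of_right_le _ h2, hh.eq_zero r h2, hh.eq_zero 2 le_rfl]
  have hlip : LipschitzWith L fun r => h (clamp r) :=
    mul_one L ▸ hL.to_restrict.comp (LipschitzWith.projIcc _)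
  exact ⟨L, hh.nonneg, fun r hr => (hh.antitone self_mem_Ici hr hr).trans_eq
    (hh.eq_one 0 le_rfl (by norm_num)), hh.eq_one, hh.eq_zero,
    fun r hr r' hr' => by rw [hclamp hr, hclamp hr']; exact hlip r r'⟩

namespace IsLipschitzCutoff

theorem comp_abs (hh : IsLipschitzCutoff h L) : IsLipschitzCutoff (fun r => h |r|) L where
  nonneg r _ := hh.nonneg _ (abs_nonneg r)
  le_one r _ := hh.le_one _ (abs_nonneg r)
  eq_one r hr hr' := by rw [abs_of_nonneg hr, hh.eq_one r hr hr']
  eq_zero r hr := by rw [abs_of_nonneg (by linarith), hh.eq_zero r hr]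
  lipschitz r hr r' hr' := by
    simpa only [abs_of_nonneg (mem_Ici.1 hr), abs_of_nonneg (mem_Ici.1 hr')] using
      hh.lipschitz hr hr'

theorem continuous_comp_abs (hh : IsLipschitzCutoff h L) : Continuous fun r => h |r| :=
  hh.lipschitz.continuousOn.comp_continuous continuous_abs abs_nonneg

variable {X : Type*} [PseudoMetricSpace X] {t : ℝ} {x y : X}

theorem apply_dist_nonneg (hh : IsLipschitzCutoff h L) (ht : 0 < t) (x y : X) :
    0 ≤ h (dist x y / t) :=
  hh.nonneg _ (by positivity)

theorem abs_apply_dist_mul_le (hh : IsLipschitzCutoff h L) (ht : 0 < t) {a F : ℝ} (ha : |a| ≤ F)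
    (x y : X) : |h (dist x y / t) * a| ≤ F := by
  rw [abs_mul, ← one_mul F, abs_of_nonneg (hh.nonneg _ (by positivity))]
  exact mul_le_mul (hh.le_one _ (by positivity)) ha (abs_nonneg a) zero_le_one

theorem apply_dist_eq_one (hh : IsLipschitzCutoff h L) (ht : 0 < t)
    (hy : y ∈ Metric.ball x (t / 2)) : h (dist x y / t) = 1 := by
  rw [Metric.mem_ball'] at hy
  exact hh.eq_one _ (by positivity) ((div_le_iff₀ ht).2 (by linarith))

theorem apply_dist_eq_zero (hh : IsLipschitzCutoff h L) (ht : 0 < t)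
    (hy : y ∉ Metric.ball x (2 * t)) : h (dist x y / t) = 0 := by
  rw [Metric.mem_ball', not_lt] at hy
  exact hh.eq_zero _ ((le_div_iff₀ ht).2 hy)

theorem abs_apply_dist_sub_le (hh : IsLipschitzCutoff h L) (ht : 0 < t) (x x' y : X) :
    |h (dist x y / t) - h (dist x' y / t)| ≤ L * (dist x x' / t) := by
  refine (hh.lipschitz.dist_le_mul _ (mem_Ici.2 (by positivity)) _
    (mem_Ici.2 (by positivity))).trans ?_
  rw [Real.dist_eq, ← sub_div, abs_div, abs_of_pos ht]
  gcongr
  exact abs_dist_sub_le x x' y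

end IsLipschitzCutoff

theorem besselPotential_comp_abs {X : Type*} [MetricSpace X] [MeasurableSpace X] (μ : Measure X)
    (N : ℝ) (h : ℝ → ℝ) (α : ℝ) :
    besselPotential μ N (fun r => h |r|) α = besselPotential μ N h α := by
  have hdist {t : ℝ} (ht : 0 < t) (x y : X) : |dist x y / t| = dist x y / t :=
    abs_of_nonneg (by positivity)
  have hkernel (x y : X) :
      besselKernel μ N (fun r => h |r|) α x y = besselKernel μ N h α x y := by
    refine congr_arg (α * ·) (setIntegral_congr_fun measurableSet_Ioi fun t ht => ?_)
    simp only [kernelS, phi, psi, opT, hdist (mem_Ioi.1 ht)]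
  funext g x
  simp only [besselPotential, hkernel]

end Cutoff

section KernelEstimates

/-- An approximation of the identity `s` of dimension `N`, one kernel `s · · t` at each scale `t`,
with one constant `K` for its size and for its Lipschitz modulus in the first variable. -/
structure IsScaleKernel {X : Type*} [PseudoMetricSpace X] [MeasurableSpace X] (N : ℝ) (K : ℝ≥0)
    (s : X → X → ℝ → ℝ) : Prop where
  measurable : ∀ x, Measurable fun q : X × ℝ => s x q.1 q.2
  abs_le : ∀ x z t, 0 < t → |s x z t| ≤ K * t ^ (-N)
  eq_zero : ∀ x z t, 0 < t → z ∉ Metric.ball x (4 * t) → s x z t = 0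
  abs_sub_le : ∀ x x' z t, 0 < t → |s x z t - s x' z t| ≤ K * t ^ (-N) * (dist x x' / t)

theorem norm_integral_le_of_eq_zero_off {X E : Type*} [MeasurableSpace X] {μ : Measure X}
    [NormedAddCommGroup E] [NormedSpace ℝ E] {f : X → E} {F : ℝ} {s : Set X} (hs : μ s < ⊤)
    (hf : ∀ y, ‖f y‖ ≤ F) (h0 : ∀ y, y ∉ s → f y = 0) : ‖∫ y, f y ∂μ‖ ≤ F * μ.real s := by
  rw [← setIntegral_eq_integral_of_forall_compl_eq_zero h0]
  exact norm_setIntegral_le_of_norm_le_const hs fun y _ => hf y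

variable {X : Type*} [MetricSpace X] [MeasurableSpace X] {μ : Measure X} {N F m t : ℝ}
  {c C L : ℝ≥0} {h : ℝ → ℝ} {f : X → ℝ}

theorem abs_opT_le (hC : UpperGrowth μ N C) (hh : IsLipschitzCutoff h L) (ht : 0 < t)
    (hf : ∀ y, |f y| ≤ F) (x : X) : |opT μ N h t f x| ≤ 2 ^ N * C * F := by
  have hF : 0 ≤ F := (abs_nonneg _).trans (hf x)
  have hbound : |∫ y, h (dist x y / t) * f y ∂μ| ≤ F * μ.real (Metric.ball x (2 * t)) := by
    rw [← Real.norm_eq_abs]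
    exact norm_integral_le_of_eq_zero_off (hC.measure_ball_lt_top _ _)
      (fun y => hh.abs_apply_dist_mul_le ht (hf y) x y)
      fun y hy => by rw [hh.apply_dist_eq_zero ht hy, zero_mul]
  calc |opT μ N h t f x| = 1 / t ^ N * |∫ y, h (dist x y / t) * f y ∂μ| := by
        rw [opT, abs_mul, abs_of_nonneg (by positivity)]
    _ ≤ 1 / t ^ N * (F * (C * (2 * t) ^ N)) := by
        gcongr
        exact hbound.trans (by gcongr; exact hC.measureReal_ball_le x (by positivity))
    _ = 2 ^ N * C * F := by
        rw [Real.mul_rpow zero_le_two ht.le]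
        field_simp

theorem kernelS_eq_phi_mul_opT (μ : Measure X) (N : ℝ) (h : ℝ → ℝ) (ht : 0 < t) (x z : X) :
    kernelS μ N h x z t = t ^ (-N) * phi μ N h z t *
      (phi μ N h x t * opT μ N h t (fun y => h (dist z y / t) * psi μ N h y t) x) := by
  simp only [kernelS, opT, Real.rpow_neg ht.le, two_mul, Real.rpow_add ht, mul_assoc]
  field_simp

theorem kernelS_eq_zero (hh : IsLipschitzCutoff h L) (ht : 0 < t) {x z : X}
    (hz : z ∉ Metric.ball x (4 * t)) : kernelS μ N h x z t = 0 := by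
  have hzero (y : X) : h (dist x y / t) * h (dist z y / t) = 0 := by
    by_cases hy : y ∈ Metric.ball x (2 * t)
    · rw [hh.apply_dist_eq_zero (x := z) ht, mul_zero]
      rw [Metric.mem_ball] at hy hz ⊢
      linarith [dist_triangle_left z x y]
    · rw [hh.apply_dist_eq_zero ht hy, zero_mul]
  simp only [kernelS, hzero, zero_mul, integral_zero, mul_zero]

variable [OpensMeasurableSpace X]

theorem integrable_cutoff_mul (hC : UpperGrowth μ N C) (hh : IsLipschitzCutoff h L)
    (hm : Measurable h) (ht : 0 < t) (hfm : AEStronglyMeasurable f μ) (hf : ∀ y, |f y| ≤ F)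
    (x : X) : Integrable (fun y => h (dist x y / t) * f y) μ := by
  have hmeas : AEStronglyMeasurable (fun y => h (dist x y / t) * f y) μ :=
    ((hm.comp ((continuous_const.dist continuous_id).measurable.div_const t)).aestronglyMeasurable
      |>.mul hfm)
  refine (integrableOn_iff_integrable_of_support_subset (s := Metric.ball x (2 * t)) ?_).1
    (Measure.integrableOn_of_bounded (M := F) (hC.measure_ball_lt_top _ _).ne hmeas
      (ae_of_all _ fun y => hh.abs_apply_dist_mul_le ht (hf y) x y))
  exact fun y => not_imp_comm.1 fun hy => by
    simp only [hh.apply_dist_eq_zero ht hy, zero_mul]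

theorem abs_opT_sub_le (hC : UpperGrowth μ N C) (hh : IsLipschitzCutoff h L) (hm : Measurable h)
    (ht : 0 < t) (hfm : AEStronglyMeasurable f μ) (hf : ∀ y, |f y| ≤ F) (x x' : X) :
    |opT μ N h t f x - opT μ N h t f x'| ≤ 2 * 2 ^ N * C * L * F * (dist x x' / t) := by
  have hF : 0 ≤ F := (abs_nonneg _).trans (hf x)
  have hint := integrable_cutoff_mul hC hh hm ht hfm hf
  have hvol : μ.real (Metric.ball x (2 * t) ∪ Metric.ball x' (2 * t)) ≤ 2 * (C * (2 * t) ^ N) :=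
    (measureReal_union_le _ _).trans (by
      linarith [hC.measureReal_ball_le x (r := 2 * t) (by positivity),
        hC.measureReal_ball_le x' (r := 2 * t) (by positivity)])
  have hbound : |∫ y, h (dist x y / t) * f y - h (dist x' y / t) * f y ∂μ| ≤
      L * (dist x x' / t) * F * μ.real (Metric.ball x (2 * t) ∪ Metric.ball x' (2 * t)) := by
    rw [← Real.norm_eq_abs]
    refine norm_integral_le_of_eq_zero_off
      (measure_union_lt_top (hC.measure_ball_lt_top _ _) (hC.measure_ball_lt_top _ _))
      (fun y => ?_) fun y hy => ?_
    · rw [← sub_mul, Real.norm_eq_abs, abs_mul]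
      exact mul_le_mul (hh.abs_apply_dist_sub_le ht x x' y) (hf y) (abs_nonneg _) (by positivity)
    · rw [mem_union, not_or] at hy
      rw [hh.apply_dist_eq_zero ht hy.1, hh.apply_dist_eq_zero ht hy.2, zero_mul, sub_zero]
  calc |opT μ N h t f x - opT μ N h t f x'|
      = 1 / t ^ N * |∫ y, h (dist x y / t) * f y - h (dist x' y / t) * f y ∂μ| := by
        rw [opT, opT, ← mul_sub, ← integral_sub (hint x) (hint x'), abs_mul,
          abs_of_nonneg (by positivity : 0 ≤ 1 / t ^ N)]
    _ ≤ 1 / t ^ N * (L * (dist x x' / t) * F * (2 * (C * (2 * t) ^ N))) := by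
        gcongr
        exact hbound.trans (by gcongr)
    _ = 2 * 2 ^ N * C * L * F * (dist x x' / t) := by
        rw [Real.mul_rpow zero_le_two ht.le]
        field_simp

theorem le_opT (hc : LowerGrowth μ N c) (hC : UpperGrowth μ N C) (hh : IsLipschitzCutoff h L)
    (hm : Measurable h) (ht : 0 < t) (hfm : AEStronglyMeasurable f μ) (hf : ∀ y, f y ≤ F)
    (hm0 : 0 ≤ m) (hmf : ∀ y, m ≤ f y) (x : X) : c / 2 ^ N * m ≤ opT μ N h t f x := by
  have hf0 (y : X) : 0 ≤ f y := hm0.trans (hmf y)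
  have hfin := hC.measure_ball_lt_top x (t / 2)
  have hint : Integrable (fun y => h (dist x y / t) * f y) μ :=
    integrable_cutoff_mul hC hh hm ht hfm (fun y => (abs_of_nonneg (hf0 y)).trans_le (hf y)) x
  have hball : m * μ.real (Metric.ball x (t / 2)) ≤ ∫ y, h (dist x y / t) * f y ∂μ := calc
    m * μ.real (Metric.ball x (t / 2)) = ∫ _ in Metric.ball x (t / 2), m ∂μ := by
        rw [setIntegral_const, smul_eq_mul, mul_comm]
    _ ≤ ∫ y in Metric.ball x (t / 2), h (dist x y / t) * f y ∂μ := by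
        refine setIntegral_mono_on (integrableOn_const hfin.ne) hint.integrableOn
          Metric.isOpen_ball.measurableSet fun y hy => ?_
        rw [hh.apply_dist_eq_one ht hy, one_mul]
        exact hmf y
    _ ≤ ∫ y, h (dist x y / t) * f y ∂μ := setIntegral_le_integral hint
        (ae_of_all _ fun y => mul_nonneg (hh.apply_dist_nonneg ht x y) (hf0 y))
  calc c / 2 ^ N * m = 1 / t ^ N * (m * (c * (t / 2) ^ N)) := by
        rw [Real.div_rpow ht.le zero_le_two]
        field_simp
    _ ≤ opT μ N h t f x := by
        unfold opT
        gcongr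
        exact le_trans (by gcongr; exact hc.le_measureReal_ball (half_pos ht) hfin.ne) hball

section Measurability

variable [SecondCountableTopology X] [SFinite μ]

theorem measurable_opT (hm : Measurable h) {β : Type*} [MeasurableSpace β] {u : β → X}
    {τ : β → ℝ} {g : β → X → ℝ} (hu : Measurable u) (hτ : Measurable τ)
    (hg : Measurable (Function.uncurry g)) : Measurable fun b => opT μ N h (τ b) (g b) (u b) := by
  unfold opT
  refine (measurable_const.div (hτ.pow_const N)).mul (StronglyMeasurable.measurable
    (StronglyMeasurable.integral_prod_right
      (f := fun b y => h (dist (u b) y / τ b) * g b y) (Measurable.stronglyMeasurable ?_)))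
  exact (hm.comp (((hu.comp measurable_fst).dist measurable_snd).div
    (hτ.comp measurable_fst))).mul hg

theorem measurable_phi (hm : Measurable h) {β : Type*} [MeasurableSpace β] {u : β → X}
    {τ : β → ℝ} (hu : Measurable u) (hτ : Measurable τ) :
    Measurable fun b => phi μ N h (u b) (τ b) :=
  measurable_const.div (measurable_opT hm hu hτ measurable_const)

theorem measurable_psi (hm : Measurable h) {β : Type*} [MeasurableSpace β] {u : β → X}
    {τ : β → ℝ} (hu : Measurable u) (hτ : Measurable τ) :
    Measurable fun b => psi μ N h (u b) (τ b) :=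
  measurable_const.div (measurable_opT hm hu hτ
    (measurable_phi hm measurable_snd (hτ.comp measurable_fst)))

end Measurability

theorem opT_one_mem_Icc (hc : LowerGrowth μ N c) (hC : UpperGrowth μ N C)
    (hh : IsLipschitzCutoff h L) (hm : Measurable h) (ht : 0 < t) (x : X) :
    opT μ N h t (fun _ => 1) x ∈ Icc (c / 2 ^ N : ℝ) (2 ^ N * C) := by
  constructor
  · simpa using le_opT hc hC hh hm ht aestronglyMeasurable_const (fun _ => le_rfl)
      zero_le_one (fun _ => le_rfl) x
  · simpa using (le_abs_self _).trans (abs_opT_le hC hh ht (fun _ => abs_one.le) x)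

theorem abs_phi_le (hc : LowerGrowth μ N c) (hC : UpperGrowth μ N C)
    (hh : IsLipschitzCutoff h L) (hm : Measurable h) (ht : 0 < t) (x : X) :
    |phi μ N h x t| ≤ 1 / (c / 2 ^ N) := by
  have hlow : 0 < (c / 2 ^ N : ℝ) := div_pos hc.const_pos (by positivity)
  have hle := (opT_one_mem_Icc hc hC hh hm ht x).1
  rw [phi, abs_of_nonneg (one_div_nonneg.2 (hlow.le.trans hle))]
  exact one_div_le_one_div_of_le hlow hle

theorem abs_phi_sub_le (hc : LowerGrowth μ N c) (hC : UpperGrowth μ N C)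
    (hh : IsLipschitzCutoff h L) (hm : Measurable h) (ht : 0 < t) (x x' : X) :
    |phi μ N h x t - phi μ N h x' t| ≤ 2 * 2 ^ N * C * L / (c / 2 ^ N) ^ 2 * (dist x x' / t) := by
  have hlow : 0 < (c / 2 ^ N : ℝ) := div_pos hc.const_pos (by positivity)
  have hx := (opT_one_mem_Icc hc hC hh hm ht x).1
  have hx' := (opT_one_mem_Icc hc hC hh hm ht x').1
  have hsub := abs_opT_sub_le hC hh hm ht aestronglyMeasurable_const (fun _ => abs_one.le) x' x
  rw [mul_one, dist_comm] at hsub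
  rw [phi, phi, div_sub_div _ _ (hlow.trans_le hx).ne' (hlow.trans_le hx').ne', one_mul, mul_one,
    abs_div, abs_of_pos (mul_pos (hlow.trans_le hx) (hlow.trans_le hx')), div_mul_eq_mul_div, sq]
  gcongr
  exact hlow.le.trans hx

variable [SecondCountableTopology X]

theorem abs_psi_le (hc : LowerGrowth μ N c) (hC : UpperGrowth μ N C)
    (hh : IsLipschitzCutoff h L) (hm : Measurable h) (ht : 0 < t) (x : X) :
    |psi μ N h x t| ≤ 2 ^ N * C / (c / 2 ^ N) := by
  have := hC.sigmaFinite
  have hlow : 0 < (c / 2 ^ N : ℝ) := div_pos hc.const_pos (by positivity)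
  have hup : 0 < (2 ^ N * C : ℝ) := mul_pos (by positivity) hC.const_pos
  have hphi (y : X) : 1 / (2 ^ N * C : ℝ) ≤ phi μ N h y t :=
    have hy := opT_one_mem_Icc hc hC hh hm ht y
    one_div_le_one_div_of_le (hlow.trans_le hy.1) hy.2
  have hle : (c / 2 ^ N) * (1 / (2 ^ N * C)) ≤ opT μ N h t (fun y => phi μ N h y t) x :=
    le_opT hc hC hh hm ht (measurable_phi hm measurable_id measurable_const).aestronglyMeasurable
      (fun y => (le_abs_self _).trans (abs_phi_le hc hC hh hm ht y)) (by positivity) hphi x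
  have hpos : 0 < (c / 2 ^ N : ℝ) * (1 / (2 ^ N * C)) := by positivity
  calc |psi μ N h x t| = 1 / opT μ N h t (fun y => phi μ N h y t) x :=
        abs_of_nonneg (one_div_nonneg.2 (hpos.le.trans hle))
    _ ≤ 1 / ((c / 2 ^ N) * (1 / (2 ^ N * C))) := one_div_le_one_div_of_le hpos hle
    _ = 2 ^ N * C / (c / 2 ^ N) := by field_simp

theorem measurable_kernelS [SFinite μ] (hm : Measurable h) (x : X) :
    Measurable fun q : X × ℝ => kernelS μ N h x q.1 q.2 := by
  unfold kernelS
  refine (((measurable_phi hm measurable_const measurable_snd).mul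
    (measurable_phi hm measurable_fst measurable_snd)).div (measurable_snd.pow_const _)).mul
    (StronglyMeasurable.measurable (StronglyMeasurable.integral_prod_right
      (f := fun (q : X × ℝ) z => h (dist x z / q.2) * h (dist q.1 z / q.2) * psi μ N h z q.2)
      (Measurable.stronglyMeasurable ?_)))
  have ht : Measurable fun q : (X × ℝ) × X => q.1.2 := measurable_snd.comp measurable_fst
  exact ((hm.comp ((measurable_const.dist measurable_snd).div ht)).mul
    (hm.comp (((measurable_fst.comp measurable_fst).dist measurable_snd).div ht))).mul
    (measurable_psi hm measurable_snd ht)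

theorem abs_kernelS_le (hc : LowerGrowth μ N c) (hC : UpperGrowth μ N C)
    (hh : IsLipschitzCutoff h L) (hm : Measurable h) (ht : 0 < t) (x z : X) :
    |kernelS μ N h x z t| ≤ (2 ^ N * C) ^ 2 / (c / 2 ^ N) ^ 3 * t ^ (-N) := by
  have hψ (y : X) := hh.abs_apply_dist_mul_le ht (abs_psi_le hc hC hh hm ht y) z y
  calc |kernelS μ N h x z t|
      = t ^ (-N) * |phi μ N h z t| * (|phi μ N h x t| *
          |opT μ N h t (fun y => h (dist z y / t) * psi μ N h y t) x|) := by
        rw [kernelS_eq_phi_mul_opT μ N h ht, abs_mul, abs_mul, abs_mul,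
          abs_of_pos (Real.rpow_pos_of_pos ht _)]
    _ ≤ t ^ (-N) * (1 / (c / 2 ^ N)) * (1 / (c / 2 ^ N) *
          (2 ^ N * C * (2 ^ N * C / (c / 2 ^ N)))) := by
        gcongr
        exacts [abs_phi_le hc hC hh hm ht z, abs_phi_le hc hC hh hm ht x, abs_opT_le hC hh ht hψ x]
    _ = (2 ^ N * C) ^ 2 / (c / 2 ^ N) ^ 3 * t ^ (-N) := by ring

theorem abs_kernelS_sub_le (hc : LowerGrowth μ N c) (hC : UpperGrowth μ N C)
    (hh : IsLipschitzCutoff h L) (hm : Measurable h) (ht : 0 < t) (x x' z : X) :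
    |kernelS μ N h x z t - kernelS μ N h x' z t| ≤
      2 * L * (2 ^ N * C / (c / 2 ^ N) + 1) * ((2 ^ N * C) ^ 2 / (c / 2 ^ N) ^ 3) * t ^ (-N) *
        (dist x x' / t) := by
  have := hC.sigmaFinite
  have hψ (y : X) := hh.abs_apply_dist_mul_le ht (abs_psi_le hc hC hh hm ht y) z y
  have hψm : AEStronglyMeasurable (fun y => h (dist z y / t) * psi μ N h y t) μ :=
    ((hm.comp ((measurable_const.dist measurable_id).div_const t)).mul
      (measurable_psi hm measurable_id measurable_const)).aestronglyMeasurable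
  set T : X → ℝ := opT μ N h t fun y => h (dist z y / t) * psi μ N h y t with hT
  have hsplit : phi μ N h x t * T x - phi μ N h x' t * T x' =
      (phi μ N h x t - phi μ N h x' t) * T x + phi μ N h x' t * (T x - T x') := by ring
  calc |kernelS μ N h x z t - kernelS μ N h x' z t|
      = t ^ (-N) * |phi μ N h z t| *
          |(phi μ N h x t - phi μ N h x' t) * T x + phi μ N h x' t * (T x - T x')| := by
        rw [kernelS_eq_phi_mul_opT μ N h ht, kernelS_eq_phi_mul_opT μ N h ht, ← mul_sub, ← hT,
          hsplit, abs_mul, abs_mul, abs_of_pos (Real.rpow_pos_of_pos ht _)]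
    _ ≤ t ^ (-N) * |phi μ N h z t| * (|phi μ N h x t - phi μ N h x' t| * |T x| +
          |phi μ N h x' t| * |T x - T x'|) := by
        rw [← abs_mul, ← abs_mul]
        gcongr
        exact abs_add_le _ _
    _ ≤ t ^ (-N) * (1 / (c / 2 ^ N)) * (2 * 2 ^ N * C * L / (c / 2 ^ N) ^ 2 * (dist x x' / t) *
          (2 ^ N * C * (2 ^ N * C / (c / 2 ^ N))) + 1 / (c / 2 ^ N) *
            (2 * 2 ^ N * C * L * (2 ^ N * C / (c / 2 ^ N)) * (dist x x' / t))) := by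
        gcongr
        exacts [abs_phi_le hc hC hh hm ht z, abs_phi_sub_le hc hC hh hm ht x x',
          abs_opT_le hC hh ht hψ x, abs_phi_le hc hC hh hm ht x',
          abs_opT_sub_le hC hh hm ht hψm hψ x x']
    _ = _ := by ring

theorem exists_isScaleKernel_kernelS (hc : LowerGrowth μ N c) (hC : UpperGrowth μ N C)
    (hh : IsLipschitzCutoff h L) (hm : Measurable h) :
    ∃ K, IsScaleKernel N K (kernelS μ N h) := by
  have := hC.sigmaFinite
  set K₀ : ℝ := (2 ^ N * C) ^ 2 / (c / 2 ^ N) ^ 3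
  set K₁ : ℝ := 2 * L * (2 ^ N * C / (c / 2 ^ N) + 1) * K₀
  have hpos : 0 ≤ K₀ := by positivity
  refine ⟨⟨max K₀ K₁, le_max_of_le_left hpos⟩, measurable_kernelS hm, fun x z t ht => ?_,
    fun x z t ht => kernelS_eq_zero hh ht, fun x x' z t ht => ?_⟩
  · refine (abs_kernelS_le hc hC hh hm ht x z).trans ?_
    gcongr
    exact le_max_left _ _
  · refine (abs_kernelS_sub_le hc hC hh hm ht x x' z).trans ?_
    gcongr
    exact le_max_right _ _

end KernelEstimates

section LayerCake

theorem lintegral_Ioc_rpow {s r : ℝ} (hs : 0 < s) (hr : 0 ≤ r) :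
    ∫⁻ t in Ioc 0 r, ENNReal.ofReal (t ^ (s - 1)) = ENNReal.ofReal (r ^ s / s) := by
  have hint : IntervalIntegrable (fun t : ℝ => t ^ (s - 1)) volume 0 r :=
    intervalIntegral.intervalIntegrable_rpow' (by linarith)
  rw [← ofReal_integral_eq_lintegral_ofReal
    ((intervalIntegrable_iff_integrableOn_Ioc_of_le hr).1 hint)
    (ae_restrict_of_forall_mem measurableSet_Ioc fun t ht => Real.rpow_nonneg ht.1.le _),
    ← intervalIntegral.integral_of_le hr, integral_rpow (Or.inl (by linarith))]
  simp [Real.zero_rpow hs.ne']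

theorem lintegral_Ioi_rpow_neg {s r : ℝ} (hs : 0 < s) (hr : 0 < r) :
    ∫⁻ t in Ioi r, ENNReal.ofReal (t ^ (-s - 1)) = ENNReal.ofReal (r ^ (-s) / s) := by
  rw [← ofReal_integral_eq_lintegral_ofReal (integrableOn_Ioi_rpow_of_lt (by linarith) hr)
    (ae_restrict_of_forall_mem measurableSet_Ioi fun t ht => Real.rpow_nonneg (hr.trans ht).le _),
    integral_Ioi_rpow_of_lt (by linarith) hr, sub_add_cancel, div_neg, neg_div, neg_neg]

variable {X : Type*} [MeasurableSpace X] {μ : Measure X} {F f : X → ℝ≥0∞}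

theorem lintegral_rpow_eq_lintegral_measure_lt_mul {s : ℝ} (hs : 0 < s) (hF : AEMeasurable F μ) :
    ∫⁻ x, F x ^ s ∂μ = ENNReal.ofReal s *
      ∫⁻ t in Ioi (0 : ℝ), μ {x | ENNReal.ofReal t < F x} * ENNReal.ofReal (t ^ (s - 1)) := by
  by_cases hfin : ∀ᵐ x ∂μ, F x ≠ ⊤
  · have hcake := lintegral_rpow_eq_lintegral_meas_lt_mul μ
      (ae_of_all _ fun x => (F x).toReal_nonneg) hF.ennreal_toReal hs
    convert hcake using 1
    · refine lintegral_congr_ae (hfin.mono fun x hx => ?_)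
      simp only [← ENNReal.ofReal_rpow_of_nonneg ENNReal.toReal_nonneg hs.le,
        ENNReal.ofReal_toReal hx]
    · refine congr_arg _ (setLIntegral_congr_fun measurableSet_Ioi fun t ht => ?_)
      have hlevel : {x | ENNReal.ofReal t < F x} =ᵐ[μ] {x | t < (F x).toReal} :=
        hfin.mono fun x hx => propext (ENNReal.ofReal_lt_iff_lt_toReal (mem_Ioi.1 ht).le hx)
      simp only [measure_congr hlevel]
  · have hpos : μ {x | F x = ⊤} ≠ 0 := fun h0 => hfin (by simpa [ae_iff] using h0)
    have hlhs : ∫⁻ x, F x ^ s ∂μ = ⊤ := by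
      refine lintegral_eq_top_of_measure_eq_top_ne_zero (hF.pow_const s) ?_
      simpa only [ENNReal.rpow_eq_top_iff_of_pos hs] using hpos
    have hpow : ∫⁻ t in Ioi (0 : ℝ), ENNReal.ofReal (t ^ (s - 1)) = ⊤ := by
      by_contra htop
      exact not_integrableOn_Ioi_rpow (s - 1) ((lintegral_ofReal_ne_top_iff_integrable
        (by fun_prop) (ae_restrict_of_forall_mem measurableSet_Ioi
          fun t ht => Real.rpow_nonneg (mem_Ioi.1 ht).le _)).1 htop)
    have hrhs : μ {x | F x = ⊤} * ⊤ ≤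
        ∫⁻ t in Ioi (0 : ℝ), μ {x | ENNReal.ofReal t < F x} * ENNReal.ofReal (t ^ (s - 1)) := by
      nth_rewrite 2 [← hpow]
      rw [← lintegral_const_mul _ (by fun_prop)]
      gcongr with t x
      rintro (hx : F x = ⊤)
      exact hx ▸ ENNReal.ofReal_lt_top
    rw [ENNReal.mul_top hpos, top_le_iff] at hrhs
    rw [hlhs, hrhs, ENNReal.mul_top (by simpa using hs)]

theorem lintegral_rpow_le_of_mul_measure_lt_le [SFinite μ] {A : ℝ≥0} {p : ℝ} (hp : 1 < p)
    (hF : AEMeasurable F μ) (hf : AEMeasurable f μ)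
    (hweak : ∀ t : ℝ, 0 < t → ENNReal.ofReal t * μ {x | ENNReal.ofReal t < F x} ≤
      A * ∫⁻ x in {x | ENNReal.ofReal t < f x}, f x ∂μ) :
    ∫⁻ x, F x ^ p ∂μ ≤ A * ENNReal.ofReal (p / (p - 1)) * ∫⁻ x, f x ^ p ∂μ := by
  have hp1 : 0 < p - 1 := by linarith
  -- After integration in `t`, the bound is the layer-cake formula for the measure `f μ`.
  let ν : Measure X := μ.withDensity f
  have hlevel (t : ℝ) (ht : 0 < t) :
      μ {x | ENNReal.ofReal t < F x} * ENNReal.ofReal (t ^ (p - 1)) ≤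
        A * (ν {x | ENNReal.ofReal t < f x} * ENNReal.ofReal (t ^ (p - 1 - 1))) := by
    have hpow : ENNReal.ofReal (t ^ (p - 1)) =
        ENNReal.ofReal t * ENNReal.ofReal (t ^ (p - 1 - 1)) := by
      rw [← ENNReal.ofReal_mul ht.le, Real.rpow_sub_one ht.ne' (p - 1), mul_div_cancel₀ _ ht.ne']
    rw [hpow, withDensity_apply', ← mul_assoc, ← mul_assoc, mul_comm (μ _)]
    exact mul_le_mul_left (hweak t ht) _
  have hν : ∫⁻ x, f x ^ (p - 1) ∂ν = ∫⁻ x, f x ^ p ∂μ := by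
    rw [lintegral_withDensity_eq_lintegral_mul₀ hf (hf.pow_const _)]
    refine lintegral_congr fun x => ?_
    rw [Pi.mul_apply, mul_comm]
    nth_rewrite 2 [← ENNReal.rpow_one (f x)]
    rw [← ENNReal.rpow_add_of_nonneg _ _ hp1.le zero_le_one, sub_add_cancel]
  calc ∫⁻ x, F x ^ p ∂μ
      ≤ ENNReal.ofReal p * ∫⁻ t in Ioi (0 : ℝ), A * (ν {x | ENNReal.ofReal t < f x} *
          ENNReal.ofReal (t ^ (p - 1 - 1))) := by
        rw [lintegral_rpow_eq_lintegral_measure_lt_mul (by linarith) hF]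
        gcongr 1
        exact setLIntegral_mono' measurableSet_Ioi hlevel
    _ = A * ENNReal.ofReal (p / (p - 1)) * ∫⁻ x, f x ^ (p - 1) ∂ν := by
        rw [lintegral_const_mul' _ _ ENNReal.coe_ne_top, lintegral_rpow_eq_lintegral_measure_lt_mul
          hp1 (hf.mono_ac (withDensity_absolutelyContinuous μ f)), ← mul_assoc, ← mul_assoc,
          mul_assoc (A : ℝ≥0∞), ← ENNReal.ofReal_mul (by positivity), div_mul_cancel₀ _ hp1.ne',
          mul_comm (A : ℝ≥0∞)]
    _ = A * ENNReal.ofReal (p / (p - 1)) * ∫⁻ x, f x ^ p ∂μ := by rw [hν]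

end LayerCake

section MaximalFunction

variable {X : Type*} [PseudoMetricSpace X] [MeasurableSpace X] {μ : Measure X} {N r : ℝ} {C : ℝ≥0}
  {f g : X → ℝ≥0∞} {x : X}

/-- The average of `f` over the ball `B(x, r)`, normalised by `r ^ N` in place of the measure of
the ball. -/
noncomputable def ballAverage (μ : Measure X) (N : ℝ) (f : X → ℝ≥0∞) (x : X) (r : ℝ) : ℝ≥0∞ :=
  ENNReal.ofReal (r ^ (-N)) * ∫⁻ z in Metric.ball x r, f z ∂μ

/-- The centred Hardy–Littlewood maximal function, for the averages `ballAverage`. It controls the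
small scales of the Bessel potential. -/
noncomputable def maximalFunction (μ : Measure X) (N : ℝ) (f : X → ℝ≥0∞) (x : X) : ℝ≥0∞ :=
  ⨆ (r : ℝ) (_ : 0 < r), ballAverage μ N f x r

theorem ballAverage_le_maximalFunction (hr : 0 < r) :
    ballAverage μ N f x r ≤ maximalFunction μ N f x :=
  le_iSup₂ (f := fun r (_ : 0 < r) => ballAverage μ N f x r) r hr

theorem ofReal_rpow_mul_ballAverage (hr : 0 < r) :
    ENNReal.ofReal (r ^ N) * ballAverage μ N f x r = ∫⁻ z in Metric.ball x r, f z ∂μ := by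
  rw [ballAverage, ← mul_assoc, ← ENNReal.ofReal_mul (by positivity), ← Real.rpow_add hr,
    add_neg_cancel, Real.rpow_zero, ENNReal.ofReal_one, one_mul]

theorem ballAverage_le_eLpNorm {E : Type*} [NormedAddCommGroup E] {u : X → E}
    (hC : UpperGrowth μ N C) {p : ℝ} (hp : 1 ≤ p) (hu : AEStronglyMeasurable u μ) (hr : 0 < r) :
    ballAverage μ N (fun z => ‖u z‖ₑ) x r ≤
      C ^ (1 - 1 / p) * eLpNorm u (ENNReal.ofReal p) μ * ENNReal.ofReal (r ^ (-(N / p))) := by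
  have hp0 : 0 < p := by linarith
  have hexp : 0 ≤ 1 - 1 / p := sub_nonneg.2 ((div_le_one hp0).2 hp)
  have hHolder : ∫⁻ z in Metric.ball x r, ‖u z‖ₑ ∂μ ≤
      eLpNorm u (ENNReal.ofReal p) μ * (C * ENNReal.ofReal (r ^ N)) ^ (1 - 1 / p) := by
    have h := eLpNorm_le_eLpNorm_mul_rpow_measure_univ (μ := μ.restrict (Metric.ball x r))
      (ENNReal.one_le_ofReal.2 hp) hu.restrict
    rw [eLpNorm_one_eq_lintegral_enorm, Measure.restrict_apply_univ, ENNReal.toReal_one,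
      ENNReal.toReal_ofReal hp0.le, div_one] at h
    refine h.trans (mul_le_mul' (eLpNorm_mono_measure _ Measure.restrict_le_self) ?_)
    gcongr
    exact hC.measure_ball_le x r hr
  calc ballAverage μ N (fun z => ‖u z‖ₑ) x r
      ≤ ENNReal.ofReal (r ^ (-N)) * (eLpNorm u (ENNReal.ofReal p) μ *
          (C * ENNReal.ofReal (r ^ N)) ^ (1 - 1 / p)) := by
        unfold ballAverage
        gcongr
    _ = C ^ (1 - 1 / p) * eLpNorm u (ENNReal.ofReal p) μ *
          ENNReal.ofReal (r ^ (-N) * (r ^ N) ^ (1 - 1 / p)) := by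
        rw [ENNReal.mul_rpow_of_nonneg _ _ hexp, ENNReal.ofReal_mul (by positivity),
          ENNReal.ofReal_rpow_of_nonneg (by positivity) hexp]
        ring
    _ = C ^ (1 - 1 / p) * eLpNorm u (ENNReal.ofReal p) μ * ENNReal.ofReal (r ^ (-(N / p))) := by
        rw [← Real.rpow_mul hr.le, ← Real.rpow_add hr]
        ring_nf

theorem maximalFunction_le_add (hC : UpperGrowth μ N C) {a : ℝ≥0∞} (hfg : ∀ z, f z ≤ g z + a)
    (x : X) : maximalFunction μ N f x ≤ maximalFunction μ N g x + C * a := by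
  refine iSup₂_le fun r hr => ?_
  have hint : ∫⁻ z in Metric.ball x r, f z ∂μ ≤
      ∫⁻ z in Metric.ball x r, g z ∂μ + a * (C * ENNReal.ofReal (r ^ N)) := by
    refine (lintegral_mono hfg).trans ?_
    rw [lintegral_add_right _ measurable_const, setLIntegral_const]
    gcongr
    exact hC.measure_ball_le x r hr
  calc ballAverage μ N f x r
      ≤ ENNReal.ofReal (r ^ (-N)) *
          (∫⁻ z in Metric.ball x r, g z ∂μ + a * (C * ENNReal.ofReal (r ^ N))) := by
        unfold ballAverage
        gcongr
    _ = ballAverage μ N g x r + C * a * ENNReal.ofReal (r ^ (-N) * r ^ N) := by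
        rw [ballAverage, ENNReal.ofReal_mul (by positivity)]
        ring
    _ ≤ maximalFunction μ N g x + C * a := by
        rw [← Real.rpow_add hr, neg_add_cancel, Real.rpow_zero, ENNReal.ofReal_one, mul_one]
        gcongr
        exact ballAverage_le_maximalFunction hr

theorem UpperGrowth.mul_measure_ball_mul_le (hC : UpperGrowth μ N C) {a b : ℝ≥0∞} {k : ℝ}
    (hk : 0 < k) (hr : 0 < r) (hab : a * ENNReal.ofReal (r ^ N) ≤ b) :
    a * μ (Metric.ball x (k * r)) ≤ C * ENNReal.ofReal (k ^ N) * b :=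
  calc a * μ (Metric.ball x (k * r))
      ≤ a * (C * ENNReal.ofReal ((k * r) ^ N)) := by
        gcongr
        exact hC.measure_ball_le x _ (by positivity)
    _ = C * ENNReal.ofReal (k ^ N) * (a * ENNReal.ofReal (r ^ N)) := by
        rw [Real.mul_rpow hk.le hr.le, ENNReal.ofReal_mul (by positivity)]
        ring
    _ ≤ C * ENNReal.ofReal (k ^ N) * b := by gcongr

theorem lowerSemicontinuous_setLIntegral_ball (μ : Measure X) (f : X → ℝ≥0∞) :
    LowerSemicontinuous fun q : X × ℝ => ∫⁻ z in Metric.ball q.1 q.2, f z ∂μ := by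
  rintro ⟨x, r⟩ a ha
  have hunion : ⋃ n : ℕ, Metric.ball x (r - 1 / (n + 1)) = Metric.ball x r := by
    refine Subset.antisymm (iUnion_subset fun n => Metric.ball_subset_ball (by
      linarith [one_div_pos.2 (n.cast_add_one_pos (α := ℝ))])) fun z hz => ?_
    obtain ⟨n, hn⟩ := exists_nat_one_div_lt (sub_pos.2 (Metric.mem_ball.1 hz))
    exact mem_iUnion.2 ⟨n, by rw [Metric.mem_ball]; linarith⟩
  have hmono : Monotone fun n : ℕ => Metric.ball x (r - 1 / (n + 1 : ℝ)) :=
    fun m n hmn => Metric.ball_subset_ball (sub_le_sub_left (Nat.one_div_le_one_div hmn) r)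
  simp only [← hunion, setLIntegral_iUnion_of_directed f hmono.directed_le] at ha
  obtain ⟨n, hn⟩ := lt_iSup_iff.1 ha
  have hδ : (0 : ℝ) < 1 / (n + 1) / 2 := by positivity
  filter_upwards [Metric.ball_mem_nhds (x, r) hδ] with q hq
  obtain ⟨hqx, hqr⟩ := max_lt_iff.1 (Metric.mem_ball.1 hq)
  refine hn.trans_le (lintegral_mono_set (Metric.ball_subset_ball' ?_))
  rw [Real.dist_eq, abs_lt] at hqr
  rw [dist_comm] at hqx
  linarith

variable [OpensMeasurableSpace X]

theorem measurable_ballAverage (μ : Measure X) (N : ℝ) (f : X → ℝ≥0∞) :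
    Measurable fun q : X × ℝ => ballAverage μ N f q.1 q.2 :=
  (measurable_snd.pow_const (-N)).ennreal_ofReal.mul
    (lowerSemicontinuous_setLIntegral_ball μ f).measurable

theorem measurable_maximalFunction (μ : Measure X) (N : ℝ) (f : X → ℝ≥0∞) :
    Measurable (maximalFunction μ N f) := by
  refine (lowerSemicontinuous_biSup fun r _ => ?_).measurable
  exact (ENNReal.continuous_const_mul ENNReal.ofReal_ne_top).comp_lowerSemicontinuous
    ((lowerSemicontinuous_setLIntegral_ball μ f).comp (g := fun x => (x, r)) (by fun_prop))
    fun a b hab => mul_le_mul_right hab _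

theorem mul_measure_le_of_forall_exists_ball (hN : 0 < N) (hC : UpperGrowth μ N C) {s : Set X}
    {a : ℝ≥0∞} (ha : a ≠ ⊤) (hs : ∀ x ∈ s, ∃ r : ℝ, 0 < r ∧
      a * ENNReal.ofReal (r ^ N) ≤ ∫⁻ z in Metric.ball x r, f z ∂μ) :
    a * μ s ≤ C * ENNReal.ofReal (6 ^ N) * ∫⁻ z, f z ∂μ := by
  have hpos : (C : ℝ≥0∞) * ENNReal.ofReal (6 ^ N) ≠ 0 :=
    mul_ne_zero (by simpa using hC.const_pos.ne') (ENNReal.ofReal_pos.2 (by positivity)).ne'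
  rcases eq_or_ne a 0 with rfl | ha0
  · simp only [zero_mul, zero_le]
  rcases eq_or_ne (∫⁻ z, f z ∂μ) ⊤ with hf | hf
  · simp only [hf, ENNReal.mul_top hpos, le_top]
  choose! r hr hle using hs
  have hbdd : ∀ x ∈ s, r x ≤ ((∫⁻ z, f z ∂μ) / a).toReal ^ (1 / N) := fun x hx => by
    have hrN : ENNReal.ofReal (r x ^ N) ≤ (∫⁻ z, f z ∂μ) / a := by
      rw [ENNReal.le_div_iff_mul_le (Or.inl ha0) (Or.inl ha), mul_comm]
      exact (hle x hx).trans (setLIntegral_le_lintegral _ _)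
    rw [one_div, Real.le_rpow_inv_iff_of_pos (hr x hx).le ENNReal.toReal_nonneg hN]
    exact (ENNReal.ofReal_le_iff_le_toReal (ENNReal.div_ne_top hf ha0)).1 hrN
  have hball : ∀ x ∈ s, 0 < μ (Metric.ball x (r x)) := fun x hx => by
    refine pos_iff_ne_zero.2 fun h0 => ?_
    have hle0 := hle x hx
    rw [setLIntegral_measure_zero _ _ h0, nonpos_iff_eq_zero] at hle0
    exact mul_ne_zero ha0 (ENNReal.ofReal_pos.2 (Real.rpow_pos_of_pos (hr x hx) N)).ne' hle0
  have := hC.sigmaFinite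
  obtain ⟨u, hus, hu, hdisj, hcov⟩ := exists_countable_disjoint_ball_covering μ hr hbdd hball
  have := hu.to_subtype
  calc a * μ s ≤ a * ∑' x : u, μ (Metric.ball (x : X) (6 * r x)) := by
        gcongr
        exact (measure_mono hcov).trans (measure_biUnion_le μ hu _)
    _ ≤ ∑' x : u, C * ENNReal.ofReal (6 ^ N) * ∫⁻ z in Metric.ball (x : X) (r x), f z ∂μ := by
        rw [← ENNReal.tsum_mul_left]
        exact ENNReal.tsum_le_tsum fun x =>
          hC.mul_measure_ball_mul_le (by norm_num) (hr x (hus x.2)) (hle x (hus x.2))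
    _ = C * ENNReal.ofReal (6 ^ N) * ∫⁻ z in ⋃ x ∈ u, Metric.ball x (r x), f z ∂μ := by
        rw [ENNReal.tsum_mul_left,
          lintegral_biUnion hu (fun _ _ => Metric.isOpen_ball.measurableSet) hdisj]
    _ ≤ C * ENNReal.ofReal (6 ^ N) * ∫⁻ z, f z ∂μ := by
        gcongr
        exact Measure.restrict_le_self

theorem mul_measure_lt_maximalFunction_le (hN : 0 < N) (hC : UpperGrowth μ N C)
    (f : X → ℝ≥0∞) {a : ℝ≥0∞} (ha : a ≠ ⊤) :
    a * μ {x | a < maximalFunction μ N f x} ≤ C * ENNReal.ofReal (6 ^ N) * ∫⁻ z, f z ∂μ := by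
  refine mul_measure_le_of_forall_exists_ball hN hC ha fun x (hx : a < _) => ?_
  simp only [maximalFunction, lt_iSup_iff, exists_prop] at hx
  obtain ⟨r, hr, hlt⟩ := hx
  refine ⟨r, hr, ?_⟩
  rw [← ofReal_rpow_mul_ballAverage (N := N) hr, mul_comm]
  gcongr

theorem mul_measure_two_mul_lt_maximalFunction_le (hN : 0 < N) (hC : UpperGrowth μ N C)
    (hf : AEMeasurable f μ) {a : ℝ≥0∞} (ha : a ≠ ⊤) :
    a * μ {x | 2 * C * a < maximalFunction μ N f x} ≤
      ENNReal.ofReal (6 ^ N) * ∫⁻ z in {z | a < f z}, f z ∂μ := by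
  set g : X → ℝ≥0∞ := {z | a < f z}.indicator f
  have hfg (z : X) : f z ≤ g z + a := by
    by_cases hz : a < f z
    · simp [g, hz]
    · exact (not_lt.1 hz).trans le_add_self
  have hCa : C * a ≠ ⊤ := ENNReal.mul_ne_top ENNReal.coe_ne_top ha
  have hsub : {x | 2 * C * a < maximalFunction μ N f x} ⊆
      {x | C * a < maximalFunction μ N g x} := fun x (hx : 2 * C * a < _) => by
    have hlt := hx.trans_le (maximalFunction_le_add hC hfg x)
    rw [two_mul, add_mul] at hlt
    exact lt_of_add_lt_add_right hlt
  have hweak := mul_measure_lt_maximalFunction_le hN hC g hCa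
  rw [lintegral_indicator₀ (nullMeasurableSet_lt aemeasurable_const hf), mul_assoc, mul_assoc,
    ENNReal.mul_le_mul_iff_right (by simpa using hC.const_pos.ne') ENNReal.coe_ne_top] at hweak
  exact le_trans (by gcongr) hweak

theorem lintegral_maximalFunction_rpow_le (hN : 0 < N) (hC : UpperGrowth μ N C) {p : ℝ}
    (hp : 1 < p) (hf : AEMeasurable f μ) :
    ∫⁻ x, maximalFunction μ N f x ^ p ∂μ ≤
      (2 * C) ^ p * (ENNReal.ofReal (6 ^ N) * ENNReal.ofReal (p / (p - 1))) *
        ∫⁻ x, f x ^ p ∂μ := by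
  have hp0 : 0 ≤ p := by linarith
  have h2C : (2 * C : ℝ≥0∞) ≠ 0 := by simpa using hC.const_pos.ne'
  have h2C' : (2 * C : ℝ≥0∞) ≠ ⊤ := by finiteness
  have := hC.sigmaFinite
  have hstrong : ∫⁻ x, ((2 * C : ℝ≥0∞)⁻¹ * maximalFunction μ N f x) ^ p ∂μ ≤
      ((6 ^ N : ℝ).toNNReal : ℝ≥0∞) * ENNReal.ofReal (p / (p - 1)) * ∫⁻ x, f x ^ p ∂μ := by
    refine lintegral_rpow_le_of_mul_measure_lt_le hp
      ((measurable_maximalFunction μ N f).const_mul _).aemeasurable hf fun t _ => ?_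
    simp only [← ENNReal.div_eq_inv_mul, ENNReal.lt_div_iff_mul_lt (.inl h2C) (.inl h2C'),
      mul_comm (ENNReal.ofReal t) (2 * C)]
    exact mul_measure_two_mul_lt_maximalFunction_le hN hC hf ENNReal.ofReal_ne_top
  simp only [ENNReal.mul_rpow_of_nonneg (2 * C : ℝ≥0∞)⁻¹ _ hp0, ENNReal.inv_rpow] at hstrong
  rw [lintegral_const_mul _ ((measurable_maximalFunction μ N f).pow_const p),
    ENNReal.inv_mul_le_iff (ENNReal.rpow_pos (pos_iff_ne_zero.2 h2C) h2C').ne' (by finiteness),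
    ← mul_assoc] at hstrong
  exact hstrong

end MaximalFunction

section MultiscaleAverages

/-- The weight `α t^α / (1 + t^α)^2 / t` of the scale `t` in the Bessel kernel. -/
noncomputable def besselWeight (α t : ℝ) : ℝ :=
  α * (t ^ α / (1 + t ^ α) ^ 2 / t)

variable {α β γ r : ℝ}

theorem measurable_besselWeight (α : ℝ) : Measurable (besselWeight α) := by
  unfold besselWeight
  fun_prop

theorem besselWeight_nonneg {t : ℝ} (hα : 0 ≤ α) (ht : 0 < t) : 0 ≤ besselWeight α t := by
  unfold besselWeight
  positivity

theorem besselWeight_le {t : ℝ} (hβ : 0 ≤ β) (hβα : β ≤ α) (ht : 0 < t) :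
    besselWeight α t ≤ α * t ^ (β - 1) := by
  have hα : 0 ≤ α := hβ.trans hβα
  have hu : 0 < t ^ α := Real.rpow_pos_of_pos ht α
  have hpow : t ^ α / (1 + t ^ α) ^ 2 ≤ t ^ β := by
    rcases le_total t 1 with ht1 | ht1
    · exact (div_le_self hu.le (by nlinarith)).trans
        (Real.rpow_le_rpow_of_exponent_ge ht ht1 hβα)
    · refine le_trans ?_ (Real.one_le_rpow ht1 hβ)
      rw [div_le_one (by positivity)]
      nlinarith
  rw [besselWeight, Real.rpow_sub_one ht.ne']
  gcongr

theorem ofReal_besselWeight_mul_le {t : ℝ} {B b : ℝ≥0∞} (hβ : 0 ≤ β) (hβα : β ≤ α) (ht : 0 < t)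
    (hb : b ≤ B * ENNReal.ofReal (t ^ (-γ))) :
    ENNReal.ofReal (besselWeight α t) * b ≤
      ENNReal.ofReal α * B * ENNReal.ofReal (t ^ (β - γ - 1)) :=
  calc ENNReal.ofReal (besselWeight α t) * b
      ≤ ENNReal.ofReal (α * t ^ (β - 1)) * (B * ENNReal.ofReal (t ^ (-γ))) := by
        gcongr
        exact besselWeight_le hβ hβα ht
    _ = ENNReal.ofReal α * B * ENNReal.ofReal (t ^ (β - 1) * t ^ (-γ)) := by
        rw [ENNReal.ofReal_mul (hβ.trans hβα), ENNReal.ofReal_mul (by positivity)]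
        ring
    _ = ENNReal.ofReal α * B * ENNReal.ofReal (t ^ (β - γ - 1)) := by
        rw [← Real.rpow_add ht]
        ring_nf

theorem setLIntegral_Ioc_besselWeight_mul_le {F : ℝ → ℝ≥0∞} {B : ℝ≥0∞} (hβ : 0 ≤ β) (hβα : β ≤ α)
    (hγβ : γ < β) (hr : 0 ≤ r) (hF : ∀ t ∈ Ioc 0 r, F t ≤ B * ENNReal.ofReal (t ^ (-γ))) :
    ∫⁻ t in Ioc 0 r, ENNReal.ofReal (besselWeight α t) * F t ≤
      ENNReal.ofReal α * B * ENNReal.ofReal (r ^ (β - γ) / (β - γ)) := by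
  rw [← lintegral_Ioc_rpow (sub_pos.2 hγβ) hr, ← lintegral_const_mul _ (by fun_prop)]
  exact setLIntegral_mono (by fun_prop) fun t ht =>
    ofReal_besselWeight_mul_le hβ hβα ht.1 (hF t ht)

theorem setLIntegral_Ioi_besselWeight_mul_le {F : ℝ → ℝ≥0∞} {B : ℝ≥0∞} (hβ : 0 ≤ β) (hβα : β ≤ α)
    (hβγ : β < γ) (hr : 0 < r) (hF : ∀ t ∈ Ioi r, F t ≤ B * ENNReal.ofReal (t ^ (-γ))) :
    ∫⁻ t in Ioi r, ENNReal.ofReal (besselWeight α t) * F t ≤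
      ENNReal.ofReal α * B * ENNReal.ofReal (r ^ (β - γ) / (γ - β)) := by
  rw [← neg_sub γ β, ← lintegral_Ioi_rpow_neg (sub_pos.2 hβγ) hr, neg_sub,
    ← lintegral_const_mul _ (by fun_prop)]
  exact setLIntegral_mono (by fun_prop) fun t (ht : r < t) =>
    ofReal_besselWeight_mul_le hβ hβα (hr.trans ht) (hF t ht)

variable {X : Type*} [PseudoMetricSpace X] [MeasurableSpace X] {μ : Measure X} {N : ℝ} {C : ℝ≥0}
  {f : X → ℝ≥0∞} {x : X}

/-- The superposition, over the scales `t ∈ T`, of the averages of `f` over the balls `B(x, 4t)`.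
It majorises the part of the Bessel potential coming from these scales: the kernels
`s(x, ·, t)` are supported in `B(x, 4t)`. -/
noncomputable def multiscaleAverage (μ : Measure X) (N α : ℝ) (f : X → ℝ≥0∞) (x : X) (T : Set ℝ) :
    ℝ≥0∞ :=
  ∫⁻ t in T, ENNReal.ofReal (besselWeight α t) * ballAverage μ N f x (4 * t)

theorem multiscaleAverage_Ioi_zero (hr : 0 ≤ r) :
    multiscaleAverage μ N α f x (Ioi 0) =
      multiscaleAverage μ N α f x (Ioc 0 r) + multiscaleAverage μ N α f x (Ioi r) := by
  rw [multiscaleAverage, ← Ioc_union_Ioi_eq_Ioi hr,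
    lintegral_union measurableSet_Ioi (Ioc_disjoint_Ioi le_rfl)]
  rfl

theorem multiscaleAverage_Ioc_le_maximalFunction (hβ : 0 < β) (hβα : β ≤ α) (hr : 0 ≤ r) :
    multiscaleAverage μ N α f x (Ioc 0 r) ≤
      ENNReal.ofReal α * maximalFunction μ N f x * ENNReal.ofReal (r ^ β / β) := by
  have hF : ∀ t ∈ Ioc 0 r, ballAverage μ N f x (4 * t) ≤
      maximalFunction μ N f x * ENNReal.ofReal (t ^ (-(0 : ℝ))) := fun t ht => by
    rw [neg_zero, Real.rpow_zero, ENNReal.ofReal_one, mul_one]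
    exact ballAverage_le_maximalFunction (mul_pos (by norm_num) ht.1)
  simpa only [sub_zero, multiscaleAverage] using
    setLIntegral_Ioc_besselWeight_mul_le hβ.le hβα hβ hr hF

section Lebesgue

variable {E : Type*} [NormedAddCommGroup E] {u : X → E} {p : ℝ}

theorem ballAverage_four_mul_le_eLpNorm (hN : 0 ≤ N) (hC : UpperGrowth μ N C) (hp : 1 ≤ p)
    (hu : AEStronglyMeasurable u μ) {t : ℝ} (ht : 0 < t) :
    ballAverage μ N (fun z => ‖u z‖ₑ) x (4 * t) ≤
      C ^ (1 - 1 / p) * eLpNorm u (ENNReal.ofReal p) μ * ENNReal.ofReal (t ^ (-(N / p))) := by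
  refine (ballAverage_le_eLpNorm hC hp hu (by positivity)).trans ?_
  refine mul_le_mul_right (ENNReal.ofReal_le_ofReal ?_) _
  exact Real.rpow_le_rpow_of_nonpos ht (by linarith)
    (neg_nonpos.2 (div_nonneg hN (by linarith)))

theorem multiscaleAverage_Ioc_le_eLpNorm (hN : 0 ≤ N) (hC : UpperGrowth μ N C) (hp : 1 ≤ p)
    (hu : AEStronglyMeasurable u μ) (hα : N / p < α) (hr : 0 ≤ r) :
    multiscaleAverage μ N α (fun z => ‖u z‖ₑ) x (Ioc 0 r) ≤
      ENNReal.ofReal α * (C ^ (1 - 1 / p) * eLpNorm u (ENNReal.ofReal p) μ) *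
        ENNReal.ofReal (r ^ (α - N / p) / (α - N / p)) :=
  setLIntegral_Ioc_besselWeight_mul_le
    ((div_nonneg hN (by linarith)).trans hα.le) le_rfl hα hr fun _ ht =>
      ballAverage_four_mul_le_eLpNorm hN hC hp hu ht.1

theorem multiscaleAverage_Ioi_le_eLpNorm (hN : 0 ≤ N) (hC : UpperGrowth μ N C) (hp : 1 ≤ p)
    (hu : AEStronglyMeasurable u μ) (hβ : 0 ≤ β) (hβα : β ≤ α) (hβN : β < N / p) (hr : 0 < r) :
    multiscaleAverage μ N α (fun z => ‖u z‖ₑ) x (Ioi r) ≤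
      ENNReal.ofReal α * (C ^ (1 - 1 / p) * eLpNorm u (ENNReal.ofReal p) μ) *
        ENNReal.ofReal (r ^ (β - N / p) / (N / p - β)) :=
  setLIntegral_Ioi_besselWeight_mul_le hβ hβα hβN hr fun _ ht =>
    ballAverage_four_mul_le_eLpNorm hN hC hp hu (hr.trans ht)

theorem ofReal_div_mul_ballAverage_four_mul_le_eLpNorm (hN : 0 ≤ N) (hC : UpperGrowth μ N C)
    (hp : 1 ≤ p) (hu : AEStronglyMeasurable u μ) {δ t : ℝ} (hδ : 0 ≤ δ) (ht : 0 < t) :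
    ENNReal.ofReal (δ / t) * ballAverage μ N (fun z => ‖u z‖ₑ) x (4 * t) ≤
      C ^ (1 - 1 / p) * eLpNorm u (ENNReal.ofReal p) μ * ENNReal.ofReal δ *
        ENNReal.ofReal (t ^ (-(1 + N / p))) := by
  have hpow : δ / t * t ^ (-(N / p)) = δ * t ^ (-(1 + N / p)) := by
    rw [neg_add, Real.rpow_add ht, Real.rpow_neg_one]
    ring
  calc ENNReal.ofReal (δ / t) * ballAverage μ N (fun z => ‖u z‖ₑ) x (4 * t)
      ≤ ENNReal.ofReal (δ / t) * (C ^ (1 - 1 / p) * eLpNorm u (ENNReal.ofReal p) μ *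
          ENNReal.ofReal (t ^ (-(N / p)))) := by
        gcongr
        exact ballAverage_four_mul_le_eLpNorm hN hC hp hu ht
    _ = C ^ (1 - 1 / p) * eLpNorm u (ENNReal.ofReal p) μ *
          ENNReal.ofReal (δ / t * t ^ (-(N / p))) := by
        rw [ENNReal.ofReal_mul (by positivity)]
        ring
    _ = C ^ (1 - 1 / p) * eLpNorm u (ENNReal.ofReal p) μ * ENNReal.ofReal δ *
          ENNReal.ofReal (t ^ (-(1 + N / p))) := by
        rw [hpow, ENNReal.ofReal_mul hδ, mul_assoc _ (ENNReal.ofReal δ)]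

end Lebesgue

variable [OpensMeasurableSpace X]

theorem measurable_besselWeight_mul_ballAverage (μ : Measure X) (N α : ℝ) (f : X → ℝ≥0∞) :
    Measurable fun q : X × ℝ =>
      ENNReal.ofReal (besselWeight α q.2) * ballAverage μ N f q.1 (4 * q.2) :=
  ((measurable_besselWeight α).comp measurable_snd).ennreal_ofReal.mul
    ((measurable_ballAverage μ N f).comp (measurable_fst.prodMk (measurable_snd.const_mul 4)))

theorem measurable_multiscaleAverage (μ : Measure X) (N α : ℝ) (f : X → ℝ≥0∞) (T : Set ℝ) :
    Measurable fun x => multiscaleAverage μ N α f x T :=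
  (measurable_besselWeight_mul_ballAverage μ N α f).lintegral_prod_right'

variable [SecondCountableTopology X]

theorem lintegral_setLIntegral_ball (ν : Measure X) [SFinite μ] [SFinite ν]
    (hf : AEMeasurable f μ) (ρ : ℝ) :
    ∫⁻ y, ∫⁻ z in Metric.ball y ρ, f z ∂μ ∂ν = ∫⁻ z, ν (Metric.ball z ρ) * f z ∂μ := by
  have hmeas : AEMeasurable (Function.uncurry fun y z => (Metric.ball y ρ).indicator f z)
      (ν.prod μ) :=
    hf.comp_snd.indicator (measurableSet_lt (measurable_snd.dist measurable_fst) measurable_const)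
  calc ∫⁻ y, ∫⁻ z in Metric.ball y ρ, f z ∂μ ∂ν
      = ∫⁻ y, ∫⁻ z, (Metric.ball y ρ).indicator f z ∂μ ∂ν := by
        simp only [lintegral_indicator Metric.isOpen_ball.measurableSet]
    _ = ∫⁻ z, ∫⁻ y, (Metric.ball z ρ).indicator (fun _ => f z) y ∂ν ∂μ := by
        rw [lintegral_lintegral_swap hmeas]
        simp only [indicator, Metric.mem_ball, dist_comm]
    _ = ∫⁻ z, ν (Metric.ball z ρ) * f z ∂μ := by
        simp only [lintegral_indicator_const Metric.isOpen_ball.measurableSet, mul_comm]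

theorem setLIntegral_ball_ballAverage_le (hC : UpperGrowth μ N C) (hf : AEMeasurable f μ)
    {ρ : ℝ} (hρ : 0 < ρ) :
    ∫⁻ y in Metric.ball x r, ballAverage μ N f y ρ ∂μ ≤
      C * ∫⁻ z in Metric.ball x (r + ρ), f z ∂μ := by
  have := hC.sigmaFinite
  have hinner (z : X) : μ.restrict (Metric.ball x r) (Metric.ball z ρ) * f z ≤
      C * ENNReal.ofReal (ρ ^ N) * (Metric.ball x (r + ρ)).indicator f z := by
    by_cases hz : z ∈ Metric.ball x (r + ρ)
    · rw [indicator_of_mem hz]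
      gcongr
      exact (Measure.restrict_apply_le _ _).trans (hC.measure_ball_le z ρ hρ)
    · have hdisj : Disjoint (Metric.ball z ρ) (Metric.ball x r) :=
        Metric.ball_disjoint_ball (by rw [add_comm]; exact not_lt.1 hz)
      simp only [Measure.restrict_apply Metric.isOpen_ball.measurableSet, hdisj.inter_eq,
        measure_empty, zero_mul, zero_le]
  calc ∫⁻ y in Metric.ball x r, ballAverage μ N f y ρ ∂μ
      = ENNReal.ofReal (ρ ^ (-N)) *
          ∫⁻ z, μ.restrict (Metric.ball x r) (Metric.ball z ρ) * f z ∂μ := by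
        rw [← lintegral_setLIntegral_ball _ hf, ← lintegral_const_mul' _ _ ENNReal.ofReal_ne_top]
        rfl
    _ ≤ ENNReal.ofReal (ρ ^ (-N)) * (C * ENNReal.ofReal (ρ ^ N) *
          ∫⁻ z in Metric.ball x (r + ρ), f z ∂μ) := by
        gcongr
        rw [← lintegral_indicator Metric.isOpen_ball.measurableSet,
          ← lintegral_const_mul' _ _ (by finiteness)]
        exact lintegral_mono hinner
    _ = C * (ENNReal.ofReal (ρ ^ (-N) * ρ ^ N) * ∫⁻ z in Metric.ball x (r + ρ), f z ∂μ) := by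
        rw [ENNReal.ofReal_mul (by positivity)]
        ring
    _ = C * ∫⁻ z in Metric.ball x (r + ρ), f z ∂μ := by
        rw [← Real.rpow_add hρ, neg_add_cancel, Real.rpow_zero, ENNReal.ofReal_one, one_mul]

theorem setLIntegral_ball_multiscaleAverage_le (hC : UpperGrowth μ N C) (hf : AEMeasurable f μ)
    (hα : 0 < α) (hr : 0 ≤ r) :
    ∫⁻ y in Metric.ball x r, multiscaleAverage μ N α f y (Ioc 0 r) ∂μ ≤
      ENNReal.ofReal α * (C * ∫⁻ z in Metric.ball x (5 * r), f z ∂μ) *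
        ENNReal.ofReal (r ^ α / α) := by
  have := hC.sigmaFinite
  have hF : ∀ t ∈ Ioc 0 r, ∫⁻ y in Metric.ball x r, ballAverage μ N f y (4 * t) ∂μ ≤
      C * (∫⁻ z in Metric.ball x (5 * r), f z ∂μ) * ENNReal.ofReal (t ^ (-(0 : ℝ))) :=
    fun t ht => by
      rw [neg_zero, Real.rpow_zero, ENNReal.ofReal_one, mul_one]
      refine (setLIntegral_ball_ballAverage_le hC hf (mul_pos (by norm_num) ht.1)).trans ?_
      gcongr
      linarith [ht.2]
  unfold multiscaleAverage
  rw [lintegral_lintegral_swap (measurable_besselWeight_mul_ballAverage μ N α f).aemeasurable]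
  simp only [lintegral_const_mul' _ _ ENNReal.ofReal_ne_top]
  simpa only [sub_zero] using setLIntegral_Ioc_besselWeight_mul_le hα.le le_rfl hα hr hF

end MultiscaleAverages

section ScalePotential

variable {X : Type*} [PseudoMetricSpace X] [MeasurableSpace X] {μ : Measure X} {N α : ℝ} {K : ℝ≥0}
  {s : X → X → ℝ → ℝ} {g : X → ℝ}

/-- The Bessel potential with an arbitrary family of kernels `s(x, z, t)` in place of `kernelS`:
the estimates only depend on `IsScaleKernel`. -/
noncomputable def scalePotential (μ : Measure X) (s : X → X → ℝ → ℝ) (α : ℝ) (g : X → ℝ) (x : X) :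
    ℝ :=
  ∫ z, g z * (∫ t in Ioi (0 : ℝ), besselWeight α t * s x z t) ∂μ

/-- The integrand of `scalePotential` as a function of the pair `(z, t)`, for Fubini's theorem. -/
noncomputable def potentialIntegrand (s : X → X → ℝ → ℝ) (α : ℝ) (g : X → ℝ) (x : X) (q : X × ℝ) :
    ℝ :=
  g q.1 * (besselWeight α q.2 * s x q.1 q.2)

theorem besselPotential_eq_scalePotential {X : Type*} [MetricSpace X] [MeasurableSpace X]
    (μ : Measure X) (N : ℝ) (h : ℝ → ℝ) (α : ℝ) :
    besselPotential μ N h α = scalePotential μ (kernelS μ N h) α := by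
  have hker (x z : X) : besselKernel μ N h α x z =
      ∫ t in Ioi (0 : ℝ), besselWeight α t * kernelS μ N h x z t := by
    rw [besselKernel, ← integral_const_mul]
    congr 1 with t
    rw [besselWeight]
    ring
  funext g x
  simp only [besselPotential, scalePotential, hker]

theorem ofReal_rpow_neg_mul_setLIntegral_ball (f : X → ℝ≥0∞) (x : X) {t : ℝ} (ht : 0 < t) :
    ENNReal.ofReal (t ^ (-N)) * ∫⁻ z in Metric.ball x (4 * t), f z ∂μ =
      ENNReal.ofReal (4 ^ N) * ballAverage μ N f x (4 * t) := by
  rw [ballAverage, ← mul_assoc, ← ENNReal.ofReal_mul (by positivity),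
    Real.mul_rpow (by norm_num) ht.le, ← mul_assoc, ← Real.rpow_add (by norm_num), add_neg_cancel,
    Real.rpow_zero, one_mul]

theorem IsScaleKernel.aestronglyMeasurable_potentialIntegrand [SFinite μ]
    (hs : IsScaleKernel N K s) (hg : AEStronglyMeasurable g μ) (x : X) (ν : Measure ℝ)
    [SFinite ν] : AEStronglyMeasurable (potentialIntegrand s α g x) (μ.prod ν) :=
  hg.comp_fst.mul ((((measurable_besselWeight α).comp measurable_snd).mul
    (hs.measurable x)).aestronglyMeasurable)

variable [OpensMeasurableSpace X]

theorem IsScaleKernel.lintegral_enorm_mul_le (hs : IsScaleKernel N K s) (g : X → ℝ) (x : X)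
    {t : ℝ} (ht : 0 < t) :
    ∫⁻ z, ‖g z‖ₑ * ‖s x z t‖ₑ ∂μ ≤
      K * ENNReal.ofReal (4 ^ N) * ballAverage μ N (fun z => ‖g z‖ₑ) x (4 * t) := by
  rw [mul_assoc, ← ofReal_rpow_neg_mul_setLIntegral_ball _ _ ht, ← mul_assoc,
    ← lintegral_indicator Metric.isOpen_ball.measurableSet,
    ← lintegral_const_mul' _ _ (by finiteness)]
  refine lintegral_mono fun z => ?_
  by_cases hz : z ∈ Metric.ball x (4 * t)
  · rw [indicator_of_mem hz, mul_comm, Real.enorm_eq_ofReal_abs (s x z t)]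
    gcongr
    exact (ENNReal.ofReal_le_ofReal (hs.abs_le x z t ht)).trans_eq
      (ENNReal.ofReal_mul K.coe_nonneg |>.trans (by rw [ENNReal.ofReal_coe_nnreal]))
  · simp only [hs.eq_zero x z t ht hz, enorm_zero, mul_zero, zero_le]

theorem IsScaleKernel.lintegral_enorm_mul_sub_le (hs : IsScaleKernel N K s) (g : X → ℝ) (x x' : X)
    {t : ℝ} (ht : 0 < t) :
    ∫⁻ z, ‖g z‖ₑ * ‖s x z t - s x' z t‖ₑ ∂μ ≤
      K * ENNReal.ofReal (4 ^ N) * (ENNReal.ofReal (dist x x' / t) *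
        ballAverage μ N (fun z => ‖g z‖ₑ) x (4 * t) + ENNReal.ofReal (dist x x' / t) *
          ballAverage μ N (fun z => ‖g z‖ₑ) x' (4 * t)) := by
  set U := Metric.ball x (4 * t) ∪ Metric.ball x' (4 * t)
  have hpoint (z : X) : ‖g z‖ₑ * ‖s x z t - s x' z t‖ₑ ≤
      K * ENNReal.ofReal (dist x x' / t) * ENNReal.ofReal (t ^ (-N)) *
        U.indicator (fun z => ‖g z‖ₑ) z := by
    by_cases hz : z ∈ U
    · rw [indicator_of_mem hz, mul_comm, Real.enorm_eq_ofReal_abs (s x z t - s x' z t)]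
      gcongr
      refine (ENNReal.ofReal_le_ofReal (hs.abs_sub_le x x' z t ht)).trans_eq ?_
      rw [mul_right_comm, ENNReal.ofReal_mul (by positivity), ENNReal.ofReal_mul K.coe_nonneg,
        ENNReal.ofReal_coe_nnreal]
    · have hzero := not_or.1 hz
      simp only [hs.eq_zero x z t ht hzero.1, hs.eq_zero x' z t ht hzero.2, sub_zero, enorm_zero,
        mul_zero, zero_le]
  calc ∫⁻ z, ‖g z‖ₑ * ‖s x z t - s x' z t‖ₑ ∂μ
      ≤ K * ENNReal.ofReal (dist x x' / t) * ENNReal.ofReal (t ^ (-N)) *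
          ∫⁻ z in U, ‖g z‖ₑ ∂μ := by
        rw [← lintegral_indicator
          (Metric.isOpen_ball.measurableSet.union Metric.isOpen_ball.measurableSet),
          ← lintegral_const_mul' _ _ (by finiteness)]
        exact lintegral_mono hpoint
    _ ≤ K * ENNReal.ofReal (dist x x' / t) * ENNReal.ofReal (t ^ (-N)) *
          (∫⁻ z in Metric.ball x (4 * t), ‖g z‖ₑ ∂μ +
            ∫⁻ z in Metric.ball x' (4 * t), ‖g z‖ₑ ∂μ) := by
        gcongr
        exact lintegral_union_le _ _ _
    _ = _ := by
        rw [mul_assoc, mul_add (ENNReal.ofReal _), ofReal_rpow_neg_mul_setLIntegral_ball _ x ht,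
          ofReal_rpow_neg_mul_setLIntegral_ball _ x' ht]
        ring

theorem IsScaleKernel.lintegral_enorm_potentialIntegrand_le [SFinite μ] (hs : IsScaleKernel N K s)
    (hα : 0 ≤ α) (hg : AEStronglyMeasurable g μ) (x : X) {T : Set ℝ} (hT : MeasurableSet T)
    (hT0 : T ⊆ Ioi 0) :
    ∫⁻ q, ‖potentialIntegrand s α g x q‖ₑ ∂(μ.prod (volume.restrict T)) ≤
      K * ENNReal.ofReal (4 ^ N) * multiscaleAverage μ N α (fun z => ‖g z‖ₑ) x T := by
  rw [lintegral_prod_symm _ (hs.aestronglyMeasurable_potentialIntegrand hg x _).enorm,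
    multiscaleAverage, ← lintegral_const_mul' _ _ (by finiteness)]
  refine setLIntegral_mono' hT fun t ht => ?_
  have ht0 : 0 < t := hT0 ht
  simp only [potentialIntegrand, enorm_mul, Real.enorm_of_nonneg (besselWeight_nonneg hα ht0),
    mul_left_comm _ (ENNReal.ofReal (besselWeight α t))]
  rw [lintegral_const_mul' _ _ ENNReal.ofReal_ne_top]
  gcongr
  exact hs.lintegral_enorm_mul_le g x ht0

theorem IsScaleKernel.lintegral_enorm_potentialIntegrand_sub_le [SFinite μ]
    (hs : IsScaleKernel N K s) (hα : 0 ≤ α) (hg : AEStronglyMeasurable g μ) (x x' : X) {r : ℝ}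
    (hr : 0 ≤ r) :
    ∫⁻ q, ‖potentialIntegrand s α g x q - potentialIntegrand s α g x' q‖ₑ
        ∂(μ.prod (volume.restrict (Ioi r))) ≤
      K * ENNReal.ofReal (4 ^ N) * ∫⁻ t in Ioi r, ENNReal.ofReal (besselWeight α t) *
        (ENNReal.ofReal (dist x x' / t) * ballAverage μ N (fun z => ‖g z‖ₑ) x (4 * t) +
          ENNReal.ofReal (dist x x' / t) * ballAverage μ N (fun z => ‖g z‖ₑ) x' (4 * t)) := by
  rw [lintegral_prod_symm
      (fun q => ‖potentialIntegrand s α g x q - potentialIntegrand s α g x' q‖ₑ)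
      ((hs.aestronglyMeasurable_potentialIntegrand hg x _).sub
        (hs.aestronglyMeasurable_potentialIntegrand hg x' _)).enorm,
    ← lintegral_const_mul' _ _ (by finiteness)]
  refine setLIntegral_mono' measurableSet_Ioi fun t ht => ?_
  have ht0 : 0 < t := hr.trans_lt ht
  simp only [potentialIntegrand, ← mul_sub, enorm_mul,
    Real.enorm_of_nonneg (besselWeight_nonneg hα ht0),
    mul_left_comm _ (ENNReal.ofReal (besselWeight α t))]
  rw [lintegral_const_mul' _ _ ENNReal.ofReal_ne_top]
  gcongr
  exact hs.lintegral_enorm_mul_sub_le g x x' ht0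

theorem IsScaleKernel.enorm_scalePotential_le [SFinite μ] (hs : IsScaleKernel N K s) (hα : 0 ≤ α)
    (hg : AEStronglyMeasurable g μ) (x : X) :
    ‖scalePotential μ s α g x‖ₑ ≤
      K * ENNReal.ofReal (4 ^ N) * multiscaleAverage μ N α (fun z => ‖g z‖ₑ) x (Ioi 0) := by
  calc ‖scalePotential μ s α g x‖ₑ
      ≤ ∫⁻ z, ‖g z * ∫ t in Ioi (0 : ℝ), besselWeight α t * s x z t‖ₑ ∂μ :=
        enorm_integral_le_lintegral_enorm _
    _ ≤ ∫⁻ z, (∫⁻ t in Ioi (0 : ℝ), ‖potentialIntegrand s α g x (z, t)‖ₑ) ∂μ := by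
        refine lintegral_mono fun z => ?_
        rw [← integral_const_mul]
        exact enorm_integral_le_lintegral_enorm _
    _ = ∫⁻ q, ‖potentialIntegrand s α g x q‖ₑ ∂(μ.prod (volume.restrict (Ioi 0))) :=
        (lintegral_prod _ (hs.aestronglyMeasurable_potentialIntegrand hg x _).enorm).symm
    _ ≤ _ := hs.lintegral_enorm_potentialIntegrand_le hα hg x measurableSet_Ioi Subset.rfl

theorem IsScaleKernel.integrable_potentialIntegrand [SFinite μ] (hs : IsScaleKernel N K s)
    (hα : 0 ≤ α) (hg : AEStronglyMeasurable g μ) {x : X}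
    (hx : multiscaleAverage μ N α (fun z => ‖g z‖ₑ) x (Ioi 0) ≠ ⊤) :
    Integrable (potentialIntegrand s α g x) (μ.prod (volume.restrict (Ioi 0))) := by
  refine ⟨hs.aestronglyMeasurable_potentialIntegrand hg x _, ?_⟩
  exact (hs.lintegral_enorm_potentialIntegrand_le hα hg x measurableSet_Ioi Subset.rfl).trans_lt
    (by finiteness)

theorem IsScaleKernel.scalePotential_sub [SFinite μ] (hs : IsScaleKernel N K s)
    (hα : 0 ≤ α) (hg : AEStronglyMeasurable g μ) {x x' : X}
    (hx : multiscaleAverage μ N α (fun z => ‖g z‖ₑ) x (Ioi 0) ≠ ⊤)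
    (hx' : multiscaleAverage μ N α (fun z => ‖g z‖ₑ) x' (Ioi 0) ≠ ⊤) :
    scalePotential μ s α g x - scalePotential μ s α g x' =
      ∫ q, (potentialIntegrand s α g x q - potentialIntegrand s α g x' q)
        ∂(μ.prod (volume.restrict (Ioi 0))) := by
  have hint := hs.integrable_potentialIntegrand hα hg hx
  have hint' := hs.integrable_potentialIntegrand hα hg hx'
  rw [integral_sub hint hint', integral_prod _ hint, integral_prod _ hint']
  simp only [scalePotential, potentialIntegrand, integral_const_mul]

theorem IsScaleKernel.enorm_scalePotential_sub_le [SFinite μ] (hs : IsScaleKernel N K s)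
    (hα : 0 ≤ α) (hg : AEStronglyMeasurable g μ) {x x' : X} {r : ℝ} (hr : 0 ≤ r)
    (hx : multiscaleAverage μ N α (fun z => ‖g z‖ₑ) x (Ioi 0) ≠ ⊤)
    (hx' : multiscaleAverage μ N α (fun z => ‖g z‖ₑ) x' (Ioi 0) ≠ ⊤) :
    ‖scalePotential μ s α g x - scalePotential μ s α g x'‖ₑ ≤
      K * ENNReal.ofReal (4 ^ N) * multiscaleAverage μ N α (fun z => ‖g z‖ₑ) x (Ioc 0 r) +
      K * ENNReal.ofReal (4 ^ N) * multiscaleAverage μ N α (fun z => ‖g z‖ₑ) x' (Ioc 0 r) +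
      K * ENNReal.ofReal (4 ^ N) * ∫⁻ t in Ioi r, ENNReal.ofReal (besselWeight α t) *
        (ENNReal.ofReal (dist x x' / t) * ballAverage μ N (fun z => ‖g z‖ₑ) x (4 * t) +
          ENNReal.ofReal (dist x x' / t) * ballAverage μ N (fun z => ‖g z‖ₑ) x' (4 * t)) := by
  have hmeas (y : X) (ν : Measure ℝ) [SFinite ν] :=
    hs.aestronglyMeasurable_potentialIntegrand (α := α) hg y ν
  rw [hs.scalePotential_sub hα hg hx hx']
  refine (enorm_integral_le_lintegral_enorm _).trans ?_
  rw [← Ioc_union_Ioi_eq_Ioi hr, Measure.restrict_union (Ioc_disjoint_Ioi le_rfl)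
    measurableSet_Ioi, Measure.prod_add, lintegral_add_measure]
  refine add_le_add ?_ (hs.lintegral_enorm_potentialIntegrand_sub_le hα hg x x' hr)
  refine (lintegral_mono fun q => enorm_sub_le).trans ?_
  rw [lintegral_add_left' (hmeas x _).enorm]
  exact add_le_add
    (hs.lintegral_enorm_potentialIntegrand_le hα hg x measurableSet_Ioc Ioc_subset_Ioi_self)
    (hs.lintegral_enorm_potentialIntegrand_le hα hg x' measurableSet_Ioc Ioc_subset_Ioi_self)

end ScalePotential

section Oscillation

variable {X : Type*} [PseudoMetricSpace X] [MeasurableSpace X] {μ : Measure X} {N α p r : ℝ}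
  {K C : ℝ≥0} {s : X → X → ℝ → ℝ}

theorem setLIntegral_Ioi_besselWeight_mul_ballAverage_add_le (hN : 0 ≤ N)
    (hC : UpperGrowth μ N C) (hp : 1 ≤ p) (hα : 0 ≤ α) (hαN : α < 1 + N / p) (hr : 0 < r)
    {g : X → ℝ} (hg : AEStronglyMeasurable g μ) {x x' : X} (hxx' : dist x x' ≤ 2 * r) :
    ∫⁻ t in Ioi r, ENNReal.ofReal (besselWeight α t) *
        (ENNReal.ofReal (dist x x' / t) * ballAverage μ N (fun z => ‖g z‖ₑ) x (4 * t) +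
          ENNReal.ofReal (dist x x' / t) * ballAverage μ N (fun z => ‖g z‖ₑ) x' (4 * t)) ≤
      4 * ENNReal.ofReal (α / (1 + N / p - α)) * C ^ (1 - 1 / p) *
        (eLpNorm g (ENNReal.ofReal p) μ * ENNReal.ofReal (r ^ (α - N / p))) := by
  set G := eLpNorm g (ENNReal.ofReal p) μ
  have hpow : r * r ^ (α - (1 + N / p)) = r ^ (α - N / p) := by
    rw [mul_comm, ← Real.rpow_add_one hr.ne']
    ring_nf
  calc _ ≤ ENNReal.ofReal α * (C ^ (1 - 1 / p) * G * ENNReal.ofReal (dist x x') +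
          C ^ (1 - 1 / p) * G * ENNReal.ofReal (dist x x')) *
            ENNReal.ofReal (r ^ (α - (1 + N / p)) / (1 + N / p - α)) :=
        setLIntegral_Ioi_besselWeight_mul_le hα le_rfl hαN hr fun t (ht : r < t) => by
          rw [add_mul]
          exact add_le_add
            (ofReal_div_mul_ballAverage_four_mul_le_eLpNorm hN hC hp hg dist_nonneg (hr.trans ht))
            (ofReal_div_mul_ballAverage_four_mul_le_eLpNorm hN hC hp hg dist_nonneg (hr.trans ht))
    _ ≤ ENNReal.ofReal α * (C ^ (1 - 1 / p) * G * ENNReal.ofReal (2 * r) +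
          C ^ (1 - 1 / p) * G * ENNReal.ofReal (2 * r)) *
            ENNReal.ofReal (r ^ (α - (1 + N / p)) / (1 + N / p - α)) := by gcongr
    _ = 4 * ENNReal.ofReal (α / (1 + N / p - α)) * C ^ (1 - 1 / p) *
          (G * ENNReal.ofReal (r ^ (α - N / p))) := by
        have hσ : 0 < 1 + N / p - α := sub_pos.2 hαN
        rw [← hpow, ENNReal.ofReal_div_of_pos hσ, ENNReal.ofReal_div_of_pos hσ,
          ENNReal.ofReal_mul hr.le, ENNReal.ofReal_mul zero_le_two, ENNReal.ofReal_ofNat,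
          ENNReal.div_eq_inv_mul, ENNReal.div_eq_inv_mul]
        ring

theorem exists_multiscaleAverage_Ioi_zero_le_eLpNorm (hN : 0 < N) (hC : UpperGrowth μ N C)
    (hp : 1 ≤ p) (hαp : N / p < α) :
    ∃ B : ℝ≥0, ∀ g : X → ℝ, AEStronglyMeasurable g μ → ∀ x : X,
      multiscaleAverage μ N α (fun z => ‖g z‖ₑ) x (Ioi 0) ≤
        B * eLpNorm g (ENNReal.ofReal p) μ := by
  have hexp : 0 ≤ 1 - 1 / p := sub_nonneg.2 ((div_le_one (by linarith)).2 hp)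
  have hNp : 0 < N / p := by positivity
  set B : ℝ≥0∞ := ENNReal.ofReal α * C ^ (1 - 1 / p) * (ENNReal.ofReal (1 / (α - N / p)) +
    ENNReal.ofReal (1 / (N / p)))
  have hfin : B ≠ ⊤ := by finiteness
  refine ⟨B.toNNReal, fun g hg x => ?_⟩
  rw [ENNReal.coe_toNNReal hfin, multiscaleAverage_Ioi_zero zero_le_one]
  have hsmall := multiscaleAverage_Ioc_le_eLpNorm (x := x) hN.le hC hp hg hαp zero_le_one
  have hlarge := multiscaleAverage_Ioi_le_eLpNorm (x := x) hN.le hC hp hg le_rfl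
    (hNp.trans hαp).le hNp zero_lt_one
  rw [Real.one_rpow] at hsmall hlarge
  refine (add_le_add hsmall hlarge).trans_eq ?_
  rw [sub_zero]
  ring

variable [OpensMeasurableSpace X]

theorem IsScaleKernel.exists_enorm_scalePotential_sub_le (hs : IsScaleKernel N K s) (hN : 0 ≤ N)
    (hC : UpperGrowth μ N C) (hp : 1 ≤ p) (hα : 0 ≤ α) (hαN : α < 1 + N / p) :
    ∃ B : ℝ≥0, ∀ g : X → ℝ, AEStronglyMeasurable g μ → ∀ (r : ℝ) (x x' : X), 0 < r →
      dist x x' ≤ 2 * r → multiscaleAverage μ N α (fun z => ‖g z‖ₑ) x (Ioi 0) ≠ ⊤ →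
      multiscaleAverage μ N α (fun z => ‖g z‖ₑ) x' (Ioi 0) ≠ ⊤ →
      ‖scalePotential μ s α g x - scalePotential μ s α g x'‖ₑ ≤
        B * (multiscaleAverage μ N α (fun z => ‖g z‖ₑ) x (Ioc 0 r) +
          multiscaleAverage μ N α (fun z => ‖g z‖ₑ) x' (Ioc 0 r) +
          eLpNorm g (ENNReal.ofReal p) μ * ENNReal.ofReal (r ^ (α - N / p))) := by
  have := hC.sigmaFinite
  have hexp : 0 ≤ 1 - 1 / p := sub_nonneg.2 ((div_le_one (by linarith)).2 hp)
  set A : ℝ≥0∞ := K * ENNReal.ofReal (4 ^ N)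
  set D : ℝ≥0∞ := 4 * ENNReal.ofReal (α / (1 + N / p - α)) * C ^ (1 - 1 / p)
  have hfin : A * (1 + D) ≠ ⊤ := by finiteness
  refine ⟨(A * (1 + D)).toNNReal, fun g hg r x x' hr hxx' hx hx' => ?_⟩
  rw [ENNReal.coe_toNNReal hfin]
  set Φ := multiscaleAverage μ N α (fun z => ‖g z‖ₑ) x (Ioc 0 r)
  set Φ' := multiscaleAverage μ N α (fun z => ‖g z‖ₑ) x' (Ioc 0 r)
  set W := eLpNorm g (ENNReal.ofReal p) μ * ENNReal.ofReal (r ^ (α - N / p))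
  calc ‖scalePotential μ s α g x - scalePotential μ s α g x'‖ₑ
      ≤ A * Φ + A * Φ' + A * (D * W) := by
        refine (hs.enorm_scalePotential_sub_le hα hg hr.le hx hx').trans ?_
        gcongr
        exact setLIntegral_Ioi_besselWeight_mul_ballAverage_add_le hN hC hp hα hαN hr hg hxx'
    _ ≤ A * Φ + A * Φ' + A * (D * W) + A * (D * Φ + D * Φ' + W) := le_self_add
    _ = A * (1 + D) * (Φ + Φ' + W) := by ring

theorem IsScaleKernel.exists_enorm_scalePotential_le_eLpNorm (hs : IsScaleKernel N K s)
    (hN : 0 < N) (hC : UpperGrowth μ N C) (hp : 1 ≤ p) (hαp : N / p < α) :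
    ∃ B : ℝ≥0, ∀ g : X → ℝ, AEStronglyMeasurable g μ → ∀ x : X,
      ‖scalePotential μ s α g x‖ₑ ≤ B * eLpNorm g (ENNReal.ofReal p) μ := by
  have := hC.sigmaFinite
  have hα : 0 ≤ α := (div_nonneg hN.le (by linarith)).trans hαp.le
  obtain ⟨B, hB⟩ := exists_multiscaleAverage_Ioi_zero_le_eLpNorm hN hC hp hαp
  have hfin : (K * ENNReal.ofReal (4 ^ N)) * B ≠ ⊤ := by finiteness
  refine ⟨(K * ENNReal.ofReal (4 ^ N) * B).toNNReal, fun g hg x => ?_⟩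
  rw [ENNReal.coe_toNNReal hfin, mul_assoc _ (B : ℝ≥0∞)]
  refine (hs.enorm_scalePotential_le hα hg x).trans ?_
  gcongr
  exact hB g hg x

theorem IsScaleKernel.exists_holder_scalePotential {X : Type*} [MetricSpace X]
    [MeasurableSpace X] [OpensMeasurableSpace X] {μ : Measure X} {s : X → X → ℝ → ℝ}
    (hs : IsScaleKernel N K s) (hN : 0 < N) (hC : UpperGrowth μ N C) (hp : 1 ≤ p)
    (hαp : N / p < α) (hαN : α < 1 + N / p) :
    ∃ B : ℝ≥0, ∀ g : X → ℝ, MemLp g (ENNReal.ofReal p) μ → ∀ x x' : X,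
      ‖scalePotential μ s α g x - scalePotential μ s α g x'‖ₑ ≤
        B * eLpNorm g (ENNReal.ofReal p) μ * edist x x' ^ (α - N / p) := by
  have hexp : 0 ≤ 1 - 1 / p := sub_nonneg.2 ((div_le_one (by linarith)).2 hp)
  have hα : 0 ≤ α := (div_nonneg hN.le (by linarith)).trans hαp.le
  obtain ⟨B₁, hB₁⟩ := hs.exists_enorm_scalePotential_sub_le hN.le hC hp hα hαN
  obtain ⟨B₂, hB₂⟩ := exists_multiscaleAverage_Ioi_zero_le_eLpNorm hN hC hp hαp
  set D : ℝ≥0∞ := ENNReal.ofReal α * C ^ (1 - 1 / p) * ENNReal.ofReal (1 / (α - N / p))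
  have hfin : B₁ * (2 * D + 1) ≠ ⊤ := by finiteness
  refine ⟨(B₁ * (2 * D + 1)).toNNReal, fun g hg x x' => ?_⟩
  rw [ENNReal.coe_toNNReal hfin]
  rcases eq_or_ne x x' with rfl | hne
  · simp only [sub_self, enorm_zero, zero_le]
  have hr : 0 < dist x x' := dist_pos.2 hne
  have htop (y : X) : multiscaleAverage μ N α (fun z => ‖g z‖ₑ) y (Ioi 0) ≠ ⊤ :=
    ne_top_of_le_ne_top (ENNReal.mul_ne_top ENNReal.coe_ne_top hg.eLpNorm_ne_top) (hB₂ g hg.1 y)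
  have hsmall (y : X) : multiscaleAverage μ N α (fun z => ‖g z‖ₑ) y (Ioc 0 (dist x x')) ≤
      D * (eLpNorm g (ENNReal.ofReal p) μ * edist x x' ^ (α - N / p)) := by
    refine (multiscaleAverage_Ioc_le_eLpNorm hN.le hC hp hg.1 hαp hr.le).trans_eq ?_
    rw [div_eq_mul_one_div (dist x x' ^ _), ENNReal.ofReal_mul (by positivity), edist_dist,
      ENNReal.ofReal_rpow_of_pos hr]
    ring
  refine (hB₁ g hg.1 _ x x' hr (by linarith) (htop x) (htop x')).trans ?_
  rw [← ENNReal.ofReal_rpow_of_pos hr, ← edist_dist]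
  refine (mul_le_mul_right (add_le_add_left (add_le_add (hsmall x) (hsmall x')) _) _).trans_eq ?_
  ring

end Oscillation

section MeanOscillation

theorem laverage_enorm_sub_average_le {X E : Type*} [MeasurableSpace X] [NormedAddCommGroup E]
    [NormedSpace ℝ E] [CompleteSpace E] {μ : Measure X} [IsFiniteMeasure μ] [NeZero μ] {f : X → E}
    (hf : Integrable f μ) {U : X → ℝ≥0∞} {V : ℝ≥0∞}
    (h : ∀ᵐ y ∂μ, ∀ᵐ z ∂μ, ‖f y - f z‖ₑ ≤ U y + U z + V) :
    ⨍⁻ y, ‖f y - ⨍ z, f z ∂μ‖ₑ ∂μ ≤ 2 * ⨍⁻ y, U y ∂μ + V := by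
  have hpoint : ∀ᵐ y ∂μ, ‖f y - ⨍ z, f z ∂μ‖ₑ ≤ U y + ((⨍⁻ z, U z ∂μ) + V) := by
    filter_upwards [h] with y hy
    have hsub : f y - ⨍ z, f z ∂μ = ⨍ z, (f y - f z) ∂μ := by
      rw [average, average, integral_sub (integrable_const _) hf.to_average, integral_const,
        probReal_univ, one_smul]
    rw [hsub]
    refine (enorm_integral_le_lintegral_enorm _).trans
      ((lintegral_mono_ae (Measure.ae_smul_measure hy _)).trans_eq ?_)
    rw [lintegral_add_right _ measurable_const, lintegral_add_left measurable_const,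
      lintegral_const, lintegral_const, measure_univ, mul_one, mul_one, add_assoc, laverage]
  refine (lintegral_mono_ae (Measure.ae_smul_measure hpoint _)).trans_eq ?_
  rw [lintegral_add_right _ measurable_const, lintegral_const,
    measure_univ (μ := (μ univ)⁻¹ • μ), mul_one, ← add_assoc, two_mul, laverage]

variable {X : Type*} [PseudoMetricSpace X] [MeasurableSpace X] [OpensMeasurableSpace X]
  {μ : Measure X} {N α p r : ℝ} {K c C : ℝ≥0} {s : X → X → ℝ → ℝ} {g : X → ℝ}

section

variable [SecondCountableTopology X]

theorem setLIntegral_ball_multiscaleAverage_le_eLpNorm (hC : UpperGrowth μ N C) (hp : 1 ≤ p)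
    (hα : 0 < α) (hg : AEStronglyMeasurable g μ) (x : X) (hr : 0 < r) :
    ∫⁻ y in Metric.ball x r, multiscaleAverage μ N α (fun z => ‖g z‖ₑ) y (Ioc 0 r) ∂μ ≤
      C * C ^ (1 - 1 / p) * ENNReal.ofReal (5 ^ (N - N / p)) *
        (eLpNorm g (ENNReal.ofReal p) μ * ENNReal.ofReal (r ^ (α - N / p))) *
          ENNReal.ofReal (r ^ N) := by
  set G := eLpNorm g (ENNReal.ofReal p) μ
  have hpow : α * ((5 * r) ^ N * (5 * r) ^ (-(N / p))) * (r ^ α / α) =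
      5 ^ (N - N / p) * r ^ (α - N / p) * r ^ N := by
    rw [← Real.rpow_add (by positivity), ← sub_eq_add_neg, Real.mul_rpow (by norm_num) hr.le,
      mul_assoc _ (r ^ (α - N / p)), ← Real.rpow_add hr,
      show α - N / p + N = N - N / p + α by ring, Real.rpow_add hr]
    field_simp
  calc _ ≤ ENNReal.ofReal α * (C * ∫⁻ z in Metric.ball x (5 * r), ‖g z‖ₑ ∂μ) *
          ENNReal.ofReal (r ^ α / α) :=
        setLIntegral_ball_multiscaleAverage_le hC hg.enorm hα hr.le
    _ ≤ ENNReal.ofReal α * (C * (ENNReal.ofReal ((5 * r) ^ N) *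
          (C ^ (1 - 1 / p) * G * ENNReal.ofReal ((5 * r) ^ (-(N / p)))))) *
            ENNReal.ofReal (r ^ α / α) := by
        rw [← ofReal_rpow_mul_ballAverage (N := N) (by positivity : 0 < 5 * r)]
        gcongr
        exact ballAverage_le_eLpNorm hC hp hg (by positivity)
    _ = C * C ^ (1 - 1 / p) * G *
          ENNReal.ofReal (α * ((5 * r) ^ N * (5 * r) ^ (-(N / p))) * (r ^ α / α)) := by
        rw [ENNReal.ofReal_mul (by positivity), ENNReal.ofReal_mul hα.le,
          ENNReal.ofReal_mul (by positivity)]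
        ring
    _ = _ := by
        rw [hpow, ENNReal.ofReal_mul (by positivity), ENNReal.ofReal_mul (by positivity)]
        ring

theorem exists_laverage_ball_multiscaleAverage_le_eLpNorm (hc : LowerGrowth μ N c)
    (hC : UpperGrowth μ N C) (hp : 1 ≤ p) (hα : 0 < α) :
    ∃ B : ℝ≥0, ∀ g : X → ℝ, AEStronglyMeasurable g μ → ∀ (x : X) (r : ℝ), 0 < r →
      ⨍⁻ y in Metric.ball x r, multiscaleAverage μ N α (fun z => ‖g z‖ₑ) y (Ioc 0 r) ∂μ ≤
        B * (eLpNorm g (ENNReal.ofReal p) μ * ENNReal.ofReal (r ^ (α - N / p))) := by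
  have hexp : 0 ≤ 1 - 1 / p := sub_nonneg.2 ((div_le_one (by linarith)).2 hp)
  have hc0 : (c : ℝ≥0∞) ≠ 0 := ENNReal.coe_ne_zero.2 hc.const_pos.ne'
  set D : ℝ≥0∞ := C * C ^ (1 - 1 / p) * ENNReal.ofReal (5 ^ (N - N / p))
  have hfin : (c : ℝ≥0∞)⁻¹ * D ≠ ⊤ := ENNReal.mul_ne_top (ENNReal.inv_ne_top.2 hc0) (by finiteness)
  refine ⟨((c : ℝ≥0∞)⁻¹ * D).toNNReal, fun g hg x r hr => ?_⟩
  rw [ENNReal.coe_toNNReal hfin, setLAverage_eq]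
  set W := eLpNorm g (ENNReal.ofReal p) μ * ENNReal.ofReal (r ^ (α - N / p))
  refine ENNReal.div_le_of_le_mul ?_
  calc _ ≤ D * W * ENNReal.ofReal (r ^ N) :=
        setLIntegral_ball_multiscaleAverage_le_eLpNorm hC hp hα hg x hr
    _ = (c : ℝ≥0∞)⁻¹ * c * (D * W * ENNReal.ofReal (r ^ N)) := by
        rw [ENNReal.inv_mul_cancel hc0 ENNReal.coe_ne_top, one_mul]
    _ = (c : ℝ≥0∞)⁻¹ * D * W * (c * ENNReal.ofReal (r ^ N)) := by ring
    _ ≤ (c : ℝ≥0∞)⁻¹ * D * W * μ (Metric.ball x r) := by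
        gcongr
        exact hc.le_measure_ball x r hr

theorem ae_restrict_ball_multiscaleAverage_ne_top (hN : 0 < N) (hC : UpperGrowth μ N C)
    (hp : 1 ≤ p) (hα : 0 < α) (hg : MemLp g (ENNReal.ofReal p) μ) (x : X) (hr : 0 < r) :
    ∀ᵐ y ∂μ.restrict (Metric.ball x r),
      multiscaleAverage μ N α (fun z => ‖g z‖ₑ) y (Ioi 0) ≠ ⊤ := by
  have hexp : 0 ≤ 1 - 1 / p := sub_nonneg.2 ((div_le_one (by linarith)).2 hp)
  have hG : eLpNorm g (ENNReal.ofReal p) μ ≠ ⊤ := hg.eLpNorm_ne_top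
  have hsmall : ∫⁻ y in Metric.ball x r,
      multiscaleAverage μ N α (fun z => ‖g z‖ₑ) y (Ioc 0 r) ∂μ ≠ ⊤ :=
    ne_top_of_le_ne_top (by finiteness)
      (setLIntegral_ball_multiscaleAverage_le_eLpNorm hC hp hα hg.1 x hr)
  filter_upwards [ae_lt_top (measurable_multiscaleAverage μ N α _ _) hsmall] with y hy
  have hlarge : multiscaleAverage μ N α (fun z => ‖g z‖ₑ) y (Ioi r) ≠ ⊤ :=
    ne_top_of_le_ne_top (by finiteness) (multiscaleAverage_Ioi_le_eLpNorm hN.le hC hp hg.1 le_rfl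
      hα.le (by positivity) hr)
  rw [multiscaleAverage_Ioi_zero hr.le]
  exact ENNReal.add_ne_top.2 ⟨hy.ne, hlarge⟩

end

theorem IsScaleKernel.exists_laverage_ball_enorm_sub_average_le (hs : IsScaleKernel N K s)
    (hN : 0 < N) (hc : LowerGrowth μ N c) (hC : UpperGrowth μ N C) (hp : 1 ≤ p) (hα : 0 < α)
    (hαN : α < 1 + N / p) :
    ∃ B : ℝ≥0, ∀ f g : X → ℝ, MemLp g (ENNReal.ofReal p) μ → f =ᵐ[μ] scalePotential μ s α g →
      ∀ (x : X) (r : ℝ), 0 < r → IntegrableOn f (Metric.ball x r) μ →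
        ⨍⁻ y in Metric.ball x r, ‖f y - ⨍ z in Metric.ball x r, f z ∂μ‖ₑ ∂μ ≤
          B * (eLpNorm g (ENNReal.ofReal p) μ * ENNReal.ofReal (r ^ (α - N / p))) := by
  have := hC.sigmaFinite
  have := hc.isOpenPosMeasure
  have := secondCountableTopology_of_isOpenPosMeasure μ
  obtain ⟨B₁, hB₁⟩ := hs.exists_enorm_scalePotential_sub_le hN.le hC hp hα.le hαN
  obtain ⟨B₂, hB₂⟩ := exists_laverage_ball_multiscaleAverage_le_eLpNorm hc hC hp hα
  refine ⟨2 * (B₁ * B₂) + B₁, fun f g hg hfg x r hr hf => ?_⟩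
  have hfinite : IsFiniteMeasure (μ.restrict (Metric.ball x r)) :=
    isFiniteMeasure_restrict.2 (hC.measure_ball_lt_top x r).ne
  have hneZero : NeZero (μ.restrict (Metric.ball x r)) :=
    ⟨fun h => (Metric.measure_ball_pos μ x hr).ne' (Measure.restrict_eq_zero.1 h)⟩
  set W := eLpNorm g (ENNReal.ofReal p) μ * ENNReal.ofReal (r ^ (α - N / p))
  set Φ := fun y => multiscaleAverage μ N α (fun z => ‖g z‖ₑ) y (Ioc 0 r)
  have hgood : ∀ᵐ y ∂μ.restrict (Metric.ball x r), f y = scalePotential μ s α g y ∧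
      multiscaleAverage μ N α (fun z => ‖g z‖ₑ) y (Ioi 0) ≠ ⊤ ∧ y ∈ Metric.ball x r := by
    filter_upwards [ae_restrict_of_ae hfg, ae_restrict_ball_multiscaleAverage_ne_top hN hC hp hα hg
      x hr, ae_restrict_mem Metric.isOpen_ball.measurableSet] with y h₁ h₂ h₃ using ⟨h₁, h₂, h₃⟩
  have hosc : ∀ᵐ y ∂μ.restrict (Metric.ball x r), ∀ᵐ z ∂μ.restrict (Metric.ball x r),
      ‖f y - f z‖ₑ ≤ B₁ * Φ y + B₁ * Φ z + B₁ * W := by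
    filter_upwards [hgood] with y ⟨hfy, hytop, hy⟩
    filter_upwards [hgood] with z ⟨hfz, hztop, hz⟩
    rw [hfy, hfz, ← mul_add, ← mul_add]
    refine hB₁ g hg.1 r y z hr ?_ hytop hztop
    linarith [dist_triangle_right y z x, Metric.mem_ball.1 hy, Metric.mem_ball.1 hz]
  calc _ ≤ 2 * ⨍⁻ y in Metric.ball x r, B₁ * Φ y ∂μ + B₁ * W :=
        laverage_enorm_sub_average_le hf.integrable hosc
    _ ≤ 2 * (B₁ * (B₂ * W)) + B₁ * W := by
        rw [laverage, lintegral_const_mul' _ _ ENNReal.coe_ne_top]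
        gcongr
        exact hB₂ g hg.1 x r hr
    _ = _ := by
        push_cast
        ring

end MeanOscillation

section Hedberg

theorem le_mul_rpow_mul_rpow_of_forall_le_add {Q A A' M G : ℝ≥0∞} {β γ : ℝ} (hβ : 0 < β)
    (hβγ : β < γ) (hM : M ≠ 0) (hG : G ≠ 0) (hGtop : G ≠ ⊤)
    (h : ∀ r : ℝ, 0 < r →
      Q ≤ A * (M * ENNReal.ofReal (r ^ β)) + A' * (G * ENNReal.ofReal (r ^ (β - γ)))) :
    Q ≤ (A + A') * (M ^ (1 - β / γ) * G ^ (β / γ)) := by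
  have hγ : 0 < γ := hβ.trans hβγ
  have hθ : 0 < 1 - β / γ := sub_pos.2 ((div_lt_one hγ).2 hβγ)
  rcases eq_or_ne M ⊤ with rfl | hMtop
  · rcases eq_or_ne (A + A') 0 with hA | hA
    · obtain ⟨rfl, rfl⟩ := add_eq_zero.1 hA
      simpa only [zero_mul, add_zero] using h 1 one_pos
    · rw [ENNReal.top_rpow_of_pos hθ, ENNReal.top_mul (by simp [hG, hGtop]), ENNReal.mul_top hA]
      exact le_top
  obtain ⟨m, hm, rfl⟩ : ∃ m : ℝ, 0 < m ∧ M = ENNReal.ofReal m :=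
    ⟨M.toReal, ENNReal.toReal_pos hM hMtop, (ENNReal.ofReal_toReal hMtop).symm⟩
  obtain ⟨b, hb, rfl⟩ : ∃ b : ℝ, 0 < b ∧ G = ENNReal.ofReal b :=
    ⟨G.toReal, ENNReal.toReal_pos hG hGtop, (ENNReal.ofReal_toReal hGtop).symm⟩
  -- the radius at which the two terms balance
  have hr : 0 < (b / m) ^ (1 / γ) := by positivity
  have hleft : m * ((b / m) ^ (1 / γ)) ^ β = m ^ (1 - β / γ) * b ^ (β / γ) := by
    rw [← Real.rpow_mul (by positivity), Real.div_rpow hb.le hm.le, Real.rpow_sub hm,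
      Real.rpow_one, one_div_mul_eq_div]
    field_simp
  have hright : b * ((b / m) ^ (1 / γ)) ^ (β - γ) = m ^ (1 - β / γ) * b ^ (β / γ) := by
    rw [← hleft, Real.rpow_sub hr, ← Real.rpow_mul (by positivity) _ γ,
      one_div_mul_cancel hγ.ne', Real.rpow_one]
    field_simp
  refine (h _ hr).trans_eq ?_
  rw [← ENNReal.ofReal_mul hm.le, ← ENNReal.ofReal_mul hb.le, hleft, hright,
    ENNReal.ofReal_mul (by positivity), ENNReal.ofReal_rpow_of_pos hm,
    ENNReal.ofReal_rpow_of_pos hb, add_mul]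

theorem eLpNorm_le_of_enorm_le_rpow_mul {X E : Type*} [MeasurableSpace X] [NormedAddCommGroup E]
    {μ : Measure X} {F : X → E} {M : X → ℝ≥0∞} {p q : ℝ} {A B G : ℝ≥0∞} (hp : 0 < p)
    (hpq : p ≤ q) (hA : A ≠ ⊤) (hG : G ≠ ⊤)
    (hF : ∀ᵐ x ∂μ, ‖F x‖ₑ ≤ A * (M x ^ (p / q) * G ^ (1 - p / q)))
    (hM : ∫⁻ x, M x ^ p ∂μ ≤ B * G ^ p) :
    eLpNorm F (ENNReal.ofReal q) μ ≤ A * B ^ (1 / q) * G := by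
  have hq : 0 < q := hp.trans_le hpq
  have hqp : 0 ≤ q - p := sub_nonneg.2 hpq
  have hpoint : ∀ᵐ x ∂μ, ‖F x‖ₑ ^ q ≤ A ^ q * G ^ (q - p) * M x ^ p := by
    filter_upwards [hF] with x hx
    refine (ENNReal.rpow_le_rpow hx hq.le).trans_eq ?_
    rw [ENNReal.mul_rpow_of_nonneg _ _ hq.le, ENNReal.mul_rpow_of_nonneg _ _ hq.le,
      ← ENNReal.rpow_mul, ← ENNReal.rpow_mul, div_mul_cancel₀ _ hq.ne', sub_mul, one_mul,
      div_mul_cancel₀ _ hq.ne']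
    ring
  have hint : ∫⁻ x, ‖F x‖ₑ ^ q ∂μ ≤ A ^ q * B * G ^ q :=
    calc ∫⁻ x, ‖F x‖ₑ ^ q ∂μ ≤ ∫⁻ x, A ^ q * G ^ (q - p) * M x ^ p ∂μ := lintegral_mono_ae hpoint
      _ ≤ A ^ q * G ^ (q - p) * (B * G ^ p) := by
          rw [lintegral_const_mul' _ _ (by finiteness)]
          gcongr
      _ = A ^ q * B * (G ^ (q - p) * G ^ p) := by ring
      _ = A ^ q * B * G ^ q := by
          rw [← ENNReal.rpow_add_of_nonneg _ _ hqp hp.le, sub_add_cancel]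
  have hq' : 0 ≤ 1 / q := by positivity
  rw [eLpNorm_eq_lintegral_rpow_enorm_toReal (ENNReal.ofReal_pos.2 hq).ne' ENNReal.ofReal_ne_top,
    ENNReal.toReal_ofReal hq.le]
  refine (ENNReal.rpow_le_rpow hint hq').trans_eq ?_
  rw [ENNReal.mul_rpow_of_nonneg _ _ hq', ENNReal.mul_rpow_of_nonneg _ _ hq', ← ENNReal.rpow_mul,
    ← ENNReal.rpow_mul, mul_one_div_cancel hq.ne', ENNReal.rpow_one, ENNReal.rpow_one]

variable {X : Type*} [PseudoMetricSpace X] [MeasurableSpace X] {μ : Measure X} {N α p q : ℝ}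
  {K C : ℝ≥0}

theorem multiscaleAverage_Ioi_zero_eq_zero {f : X → ℝ≥0∞} {x : X}
    (hx : maximalFunction μ N f x = 0) : multiscaleAverage μ N α f x (Ioi 0) = 0 := by
  refine setLIntegral_eq_zero measurableSet_Ioi fun t (ht : 0 < t) => ?_
  have havg : ballAverage μ N f x (4 * t) ≤ 0 :=
    hx ▸ ballAverage_le_maximalFunction (by positivity)
  simp only [le_zero_iff.1 havg, mul_zero, Pi.zero_apply]

theorem maximalFunction_eq_zero {E : Type*} [NormedAddCommGroup E] {u : X → E}
    (hC : UpperGrowth μ N C) (hp : 1 ≤ p) (hu : AEStronglyMeasurable u μ)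
    (hu0 : eLpNorm u (ENNReal.ofReal p) μ = 0) (x : X) :
    maximalFunction μ N (fun z => ‖u z‖ₑ) x = 0 :=
  le_zero_iff.1 <| iSup₂_le fun r hr =>
    (ballAverage_le_eLpNorm hC hp hu hr).trans_eq (by rw [hu0, mul_zero, zero_mul])

theorem exists_multiscaleAverage_Ioi_zero_le_maximalFunction (hN : 0 < N)
    (hC : UpperGrowth μ N C) (hp : 1 ≤ p) (hpq : p < q) (hα : N * (1 / p - 1 / q) ≤ α) :
    ∃ B : ℝ≥0, ∀ g : X → ℝ, MemLp g (ENNReal.ofReal p) μ → ∀ x : X,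
      multiscaleAverage μ N α (fun z => ‖g z‖ₑ) x (Ioi 0) ≤
        B * (maximalFunction μ N (fun z => ‖g z‖ₑ) x ^ (p / q) *
          eLpNorm g (ENNReal.ofReal p) μ ^ (1 - p / q)) := by
  have hp0 : 0 < p := by linarith
  have hq0 : 0 < q := hp0.trans hpq
  have hexp : 0 ≤ 1 - 1 / p := sub_nonneg.2 ((div_le_one hp0).2 hp)
  set β := N * (1 / p - 1 / q)
  have hβ : 0 < β := mul_pos hN (sub_pos.2 (one_div_lt_one_div_of_lt hp0 hpq))
  have hθ : β / (N / p) = 1 - p / q := by simp only [β]; field_simp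
  have hβN : β < N / p := by
    rw [← div_lt_one (by positivity), hθ]
    linarith [div_pos hp0 hq0]
  set A : ℝ≥0∞ := ENNReal.ofReal α * ENNReal.ofReal (1 / β)
  set A' : ℝ≥0∞ := ENNReal.ofReal α * C ^ (1 - 1 / p) * ENNReal.ofReal (1 / (N / p - β))
  have hfin : A + A' ≠ ⊤ := by finiteness
  refine ⟨(A + A').toNNReal, fun g hg x => ?_⟩
  rw [ENNReal.coe_toNNReal hfin]
  set M := maximalFunction μ N (fun z => ‖g z‖ₑ) x
  set G := eLpNorm g (ENNReal.ofReal p) μ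
  rcases eq_or_ne M 0 with hM | hM
  · simp only [multiscaleAverage_Ioi_zero_eq_zero hM, zero_le]
  have hG : G ≠ 0 := mt (fun hG => maximalFunction_eq_zero hC hp hg.1 hG x) hM
  have hbound := le_mul_rpow_mul_rpow_of_forall_le_add (A := A) (A' := A') hβ hβN hM hG
    hg.eLpNorm_ne_top fun r hr =>
      (multiscaleAverage_Ioi_zero (μ := μ) (N := N) (α := α) hr.le).trans_le <| add_le_add
        ((multiscaleAverage_Ioc_le_maximalFunction hβ hα hr.le).trans_eq <| by
          rw [div_eq_mul_one_div (r ^ β), ENNReal.ofReal_mul (by positivity)]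
          ring)
        ((multiscaleAverage_Ioi_le_eLpNorm hN.le hC hp hg.1 hβ.le hα hβN hr).trans_eq <| by
          rw [div_eq_mul_one_div (r ^ _), ENNReal.ofReal_mul (by positivity)]
          ring)
  rwa [hθ, sub_sub_cancel] at hbound

theorem IsScaleKernel.exists_eLpNorm_scalePotential_le [OpensMeasurableSpace X]
    {s : X → X → ℝ → ℝ} (hs : IsScaleKernel N K s) (hN : 0 < N) (hC : UpperGrowth μ N C)
    (hp : 1 < p) (hpq : p < q) (hα : N * (1 / p - 1 / q) ≤ α) :
    ∃ B : ℝ≥0, ∀ g : X → ℝ, MemLp g (ENNReal.ofReal p) μ →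
      eLpNorm (scalePotential μ s α g) (ENNReal.ofReal q) μ ≤
        B * eLpNorm g (ENNReal.ofReal p) μ := by
  have := hC.sigmaFinite
  have hp0 : 0 < p := by linarith
  have hq0 : 0 ≤ 1 / q := by have := hp0.trans hpq; positivity
  have hα0 : 0 ≤ α := hα.trans' <|
    mul_nonneg hN.le (sub_nonneg.2 (one_div_le_one_div_of_le hp0 hpq.le))
  obtain ⟨B, hB⟩ := exists_multiscaleAverage_Ioi_zero_le_maximalFunction hN hC hp.le hpq hα
  set A : ℝ≥0∞ := K * ENNReal.ofReal (4 ^ N) * B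
  set D : ℝ≥0∞ := (2 * C) ^ p * (ENNReal.ofReal (6 ^ N) * ENNReal.ofReal (p / (p - 1)))
  have hA : A ≠ ⊤ := by finiteness
  have hfin : A * D ^ (1 / q) ≠ ⊤ := by finiteness
  refine ⟨(A * D ^ (1 / q)).toNNReal, fun g hg => ?_⟩
  rw [ENNReal.coe_toNNReal hfin]
  refine eLpNorm_le_of_enorm_le_rpow_mul (M := maximalFunction μ N (fun z => ‖g z‖ₑ)) hp0 hpq.le hA
    hg.eLpNorm_ne_top (ae_of_all μ fun x => ?_) ?_
  · rw [mul_assoc _ (B : ℝ≥0∞)]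
    refine (hs.enorm_scalePotential_le hα0 hg.1 x).trans ?_
    gcongr
    exact hB g hg x
  · refine (lintegral_maximalFunction_rpow_le hN hC hp hg.1.enorm).trans_eq ?_
    rw [eLpNorm_eq_lintegral_rpow_enorm_toReal (ENNReal.ofReal_pos.2 hp0).ne'
      ENNReal.ofReal_ne_top, ENNReal.toReal_ofReal hp0.le, ← ENNReal.rpow_mul,
      one_div_mul_cancel hp0.ne', ENNReal.rpow_one]

end Hedberg

section Embeddings

section ImageSpace

variable {X : Type*} [MeasurableSpace X] {μ : Measure X} {T : (X → ℝ) → X → ℝ} {p q : ℝ≥0∞}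

/-- The image `T (L^p)` of an operator `T`, with norm `‖f‖_p + inf {‖g‖_p : g ∈ L^p, T g = f}`;
`potentialSpace` is the case `T = besselPotential`. -/
noncomputable def imageSpace (μ : Measure X) (T : (X → ℝ) → X → ℝ) (p : ℝ≥0∞) :
    FunctionSpace X where
  mem f := MemLp f p μ ∧ ∃ g : X → ℝ, MemLp g p μ ∧ f =ᵐ[μ] T g
  norm f := eLpNorm f p μ + ⨅ (g : X → ℝ) (_ : MemLp g p μ ∧ f =ᵐ[μ] T g), eLpNorm g p μ

theorem potentialSpace_eq_imageSpace {X : Type*} [MetricSpace X] [MeasurableSpace X]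
    (μ : Measure X) (N : ℝ) (h : ℝ → ℝ) (α : ℝ) (p : ℝ≥0∞) :
    potentialSpace μ N h α p = imageSpace μ (besselPotential μ N h α) p :=
  rfl

theorem imageSpace_embeds {B : FunctionSpace X} (K : ℝ≥0)
    (hK : ∀ f g : X → ℝ, MemLp f p μ → MemLp g p μ → f =ᵐ[μ] T g →
      B.mem f ∧ B.norm f ≤ K * eLpNorm g p μ) :
    (imageSpace μ T p).Embeds B := by
  -- `K + 1` because multiplication by a possibly zero `K` need not commute with the infimum
  refine ⟨K + 1, fun f ⟨hf, g, hg, hfg⟩ => ⟨(hK f g hf hg hfg).1, ?_⟩⟩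
  have hK0 : ((K + 1 : ℝ≥0) : ℝ≥0∞) ≠ 0 := by simp
  calc B.norm f
      ≤ ⨅ (g : X → ℝ) (_ : MemLp g p μ ∧ f =ᵐ[μ] T g), ((K + 1 : ℝ≥0) : ℝ≥0∞) * eLpNorm g p μ :=
        le_iInf₂ fun g hg => (hK f g hf hg.1 hg.2).2.trans (by gcongr; exact le_self_add)
    _ = ((K + 1 : ℝ≥0) : ℝ≥0∞) *
          ⨅ (g : X → ℝ) (_ : MemLp g p μ ∧ f =ᵐ[μ] T g), eLpNorm g p μ := by
        simp only [ENNReal.mul_iInf_of_ne hK0 ENNReal.coe_ne_top]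
    _ ≤ _ := by
        gcongr
        exact le_add_self

theorem imageSpace_embeds_lebesgueSpace_self (μ : Measure X) (T : (X → ℝ) → X → ℝ) (p : ℝ≥0∞) :
    (imageSpace μ T p).Embeds (lebesgueSpace μ p) :=
  ⟨1, fun _ hf => ⟨hf.1, by rw [ENNReal.coe_one, one_mul]; exact le_self_add⟩⟩

theorem imageSpace_embeds_lebesgueSpace
    (hT : ∃ B : ℝ≥0, ∀ g, MemLp g p μ → eLpNorm (T g) q μ ≤ B * eLpNorm g p μ) :
    (imageSpace μ T p).Embeds (lebesgueSpace μ q) := by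
  obtain ⟨B, hB⟩ := hT
  refine imageSpace_embeds B fun f g hf hg hfg => ?_
  have hbound : eLpNorm f q μ ≤ B * eLpNorm g p μ := (eLpNorm_congr_ae hfg).trans_le (hB g hg)
  exact ⟨⟨hf.1, hbound.trans_lt (ENNReal.mul_lt_top ENNReal.coe_lt_top hg.2)⟩, hbound⟩

theorem eLpNorm_le_max_eLpNorm_top {E : Type*} [NormedAddCommGroup E] {f : X → E}
    (hp : p ≠ 0) (hpq : p ≤ q) (hfp : eLpNorm f p μ ≠ ⊤) (hftop : eLpNorm f ⊤ μ ≠ ⊤) :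
    eLpNorm f q μ ≤ max (eLpNorm f p μ) (eLpNorm f ⊤ μ) := by
  rcases eq_or_ne q ⊤ with rfl | hq
  · exact le_max_right _ _
  obtain ⟨a, ha, rfl⟩ : ∃ a : ℝ, 0 < a ∧ p = ENNReal.ofReal a :=
    have hptop : p ≠ ⊤ := ne_top_of_le_ne_top hq hpq
    ⟨p.toReal, ENNReal.toReal_pos hp hptop, (ENNReal.ofReal_toReal hptop).symm⟩
  obtain ⟨b, hab, rfl⟩ : ∃ b : ℝ, a ≤ b ∧ q = ENNReal.ofReal b :=
    ⟨q.toReal, (ENNReal.ofReal_le_iff_le_toReal hq).1 hpq, (ENNReal.ofReal_toReal hq).symm⟩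
  have hab0 : 0 ≤ a / b := div_nonneg ha.le (ha.le.trans hab)
  have hab1 : 0 ≤ 1 - a / b := sub_nonneg.2 ((div_le_one (ha.trans_le hab)).2 hab)
  set G := max (eLpNorm f (ENNReal.ofReal a) μ) (eLpNorm f ⊤ μ)
  refine (eLpNorm_le_of_enorm_le_rpow_mul (A := 1) (B := 1) (G := G) (M := fun x => ‖f x‖ₑ)
    ha hab ENNReal.one_ne_top (max_ne_top hfp hftop) ?_ ?_).trans_eq (by simp)
  · filter_upwards [enorm_ae_le_eLpNormEssSup f μ] with x hx
    calc ‖f x‖ₑ = ‖f x‖ₑ ^ (a / b) * ‖f x‖ₑ ^ (1 - a / b) := by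
          rw [← ENNReal.rpow_add_of_nonneg _ _ hab0 hab1, add_sub_cancel,
            ENNReal.rpow_one]
      _ ≤ 1 * (‖f x‖ₑ ^ (a / b) * G ^ (1 - a / b)) := by
          rw [one_mul]
          gcongr
          exact hx.trans (eLpNorm_exponent_top.symm.trans_le (le_max_right _ _))
  · calc ∫⁻ x, ‖f x‖ₑ ^ a ∂μ = eLpNorm f (ENNReal.ofReal a) μ ^ a := by
          rw [eLpNorm_eq_lintegral_rpow_enorm_toReal hp ENNReal.ofReal_ne_top,
            ENNReal.toReal_ofReal ha.le, ← ENNReal.rpow_mul, one_div_mul_cancel ha.ne',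
            ENNReal.rpow_one]
      _ ≤ 1 * G ^ a := by
          rw [one_mul]
          gcongr
          exact le_max_left _ _

theorem FunctionSpace.Embeds.lebesgueSpace_of_le {A : FunctionSpace X}
    (hAp : A.Embeds (lebesgueSpace μ p)) (hAtop : A.Embeds (lebesgueSpace μ ⊤)) (hp : p ≠ 0)
    (hpq : p ≤ q) : A.Embeds (lebesgueSpace μ q) := by
  obtain ⟨B, hB⟩ := hAp
  obtain ⟨B', hB'⟩ := hAtop
  refine ⟨max B B', fun f hf => ?_⟩
  obtain ⟨hfp, hfpB⟩ := hB f hf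
  obtain ⟨hftop, hftopB⟩ := hB' f hf
  have hbound := eLpNorm_le_max_eLpNorm_top hp hpq hfp.2.ne hftop.2.ne
  refine ⟨⟨hfp.1, hbound.trans_lt (max_lt hfp.2 hftop.2)⟩, hbound.trans (max_le ?_ ?_)⟩
  · exact hfpB.trans (by gcongr; exact le_max_left _ _)
  · exact hftopB.trans (by gcongr; exact le_max_right _ _)

end ImageSpace

variable {X : Type*} [MetricSpace X] [MeasurableSpace X] [OpensMeasurableSpace X] {μ : Measure X}
  {N α p q : ℝ} {K c C : ℝ≥0} {s : X → X → ℝ → ℝ}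

namespace IsScaleKernel

theorem imageSpace_embeds_lebesgueSpace (hs : IsScaleKernel N K s) (hN : 0 < N)
    (hC : UpperGrowth μ N C) (hp : 1 < p) (hpq : p ≤ q) (hα : N * (1 / p - 1 / q) ≤ α) :
    (imageSpace μ (scalePotential μ s α) (ENNReal.ofReal p)).Embeds
      (lebesgueSpace μ (ENNReal.ofReal q)) := by
  rcases hpq.eq_or_lt with rfl | hpq
  · exact imageSpace_embeds_lebesgueSpace_self _ _ _
  · exact AhlforsBessel.imageSpace_embeds_lebesgueSpace
      (hs.exists_eLpNorm_scalePotential_le hN hC hp hpq hα)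

theorem imageSpace_embeds_lebesgueSpace_of_lt (hs : IsScaleKernel N K s) (hN : 0 < N)
    (hC : UpperGrowth μ N C) (hp : 1 ≤ p) (hαp : N / p < α) {q : ℝ≥0∞}
    (hpq : ENNReal.ofReal p ≤ q) :
    (imageSpace μ (scalePotential μ s α) (ENNReal.ofReal p)).Embeds (lebesgueSpace μ q) := by
  obtain ⟨B, hB⟩ := hs.exists_enorm_scalePotential_le_eLpNorm hN hC hp hαp
  refine (imageSpace_embeds_lebesgueSpace_self _ _ _).lebesgueSpace_of_le
    (AhlforsBessel.imageSpace_embeds_lebesgueSpace ⟨B, fun g hg => ?_⟩)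
    (ENNReal.ofReal_pos.2 (by linarith)).ne' hpq
  rw [eLpNorm_exponent_top]
  exact essSup_le_of_ae_le _ (ae_of_all μ (hB g hg.1))

theorem imageSpace_embeds_bmoSpace (hs : IsScaleKernel N K s) (hN : 0 < N)
    (hc : LowerGrowth μ N c) (hC : UpperGrowth μ N C) (hp : 1 ≤ p) (hαp : α = N / p) :
    (imageSpace μ (scalePotential μ s α) (ENNReal.ofReal p)).Embeds (bmoSpace μ) := by
  have hα : 0 < α := hαp ▸ div_pos hN (by linarith)
  obtain ⟨B, hB⟩ := hs.exists_laverage_ball_enorm_sub_average_le hN hc hC hp hα (by linarith)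
  refine imageSpace_embeds B fun f g hf hg hfg => ?_
  have hint (x : X) (r : ℝ) : IntegrableOn f (Metric.ball x r) μ := by
    have : IsFiniteMeasure (μ.restrict (Metric.ball x r)) :=
      isFiniteMeasure_restrict.2 (hC.measure_ball_lt_top x r).ne
    exact (hf.restrict _).integrable (by simpa using hp)
  have hbound : bmoSeminorm μ f ≤ B * eLpNorm g (ENNReal.ofReal p) μ :=
    iSup_le fun x => iSup₂_le fun r hr => (hB f g hg hfg x r hr (hint x r)).trans_eq <| by
      rw [hαp, sub_self, Real.rpow_zero, ENNReal.ofReal_one, mul_one]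
  exact ⟨⟨fun x r _ => hint x r,
    hbound.trans_lt (ENNReal.mul_lt_top ENNReal.coe_lt_top hg.2)⟩, hbound⟩

theorem imageSpace_embeds_holderSpace (hs : IsScaleKernel N K s) (hN : 0 < N)
    (hC : UpperGrowth μ N C) (hp : 1 ≤ p) (hαp : N / p < α) (hαN : α < 1 + N / p) :
    (imageSpace μ (scalePotential μ s α) (ENNReal.ofReal p)).Embeds
      (holderSpace μ (α - N / p).toNNReal) := by
  obtain ⟨B, hB⟩ := hs.exists_enorm_scalePotential_le_eLpNorm hN hC hp hαp
  obtain ⟨B', hB'⟩ := hs.exists_holder_scalePotential hN hC hp hαp hαN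
  refine imageSpace_embeds (B + B') fun f g _ hg hfg => ?_
  set G := eLpNorm g (ENNReal.ofReal p) μ
  set u := scalePotential μ s α g
  have hsup : ⨆ x, ‖u x‖ₑ ≤ B * G := iSup_le (hB g hg.1)
  have hholder : HolderWith (B' * G.toNNReal) (α - N / p).toNNReal u := fun x x' => by
    rw [edist_eq_enorm_sub, ENNReal.coe_mul, ENNReal.coe_toNNReal hg.2.ne,
      Real.coe_toNNReal _ (sub_pos.2 hαp).le]
    exact hB' g hg x x'
  have hseminorm : eHolderNorm (α - N / p).toNNReal u ≤ B' * G := by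
    refine hholder.eHolderNorm_le.trans_eq ?_
    rw [ENNReal.coe_mul, ENNReal.coe_toNNReal hg.2.ne]
  refine ⟨⟨u, hfg, hsup.trans_lt (ENNReal.mul_lt_top ENNReal.coe_lt_top hg.2),
    hholder.memHolder⟩, (iInf₂_le u hfg).trans ?_⟩
  rw [ENNReal.coe_add, add_mul]
  exact add_le_add hsup hseminorm

end IsScaleKernel

theorem IsLipschitzCutoff.exists_potentialSpace_eq_imageSpace {h : ℝ → ℝ} {L : ℝ≥0}
    (hh : IsLipschitzCutoff h L) (hc : LowerGrowth μ N c) (hC : UpperGrowth μ N C) :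
    ∃ (K : ℝ≥0) (s : X → X → ℝ → ℝ), IsScaleKernel N K s ∧
      ∀ α p, potentialSpace μ N h α p = imageSpace μ (scalePotential μ s α) p := by
  have := hC.sigmaFinite
  have := hc.isOpenPosMeasure
  have := secondCountableTopology_of_isOpenPosMeasure μ
  obtain ⟨K, hK⟩ := exists_isScaleKernel_kernelS hc hC hh.comp_abs hh.continuous_comp_abs.measurable
  exact ⟨K, _, hK, fun α p => by
    rw [potentialSpace_eq_imageSpace, ← besselPotential_comp_abs,
      besselPotential_eq_scalePotential]⟩

theorem mul_one_div_sub_one_div_le (hN : 0 < N) (hq : 0 < q) (hα : N / p ≤ α) :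
    N * (1 / p - 1 / q) ≤ α := by
  rw [mul_sub, mul_one_div]
  linarith [mul_pos hN (one_div_pos.2 hq)]

end Embeddings

end AhlforsBessel

open AhlforsBessel in
theorem mainTheorem6_general {X : Type*} [MetricSpace X] [MeasurableSpace X]
    [OpensMeasurableSpace X] {μ : Measure X} {N : ℝ} (hreg : IsAhlforsRegular μ N)
    (hμ : μ univ = ⊤) {h : ℝ → ℝ} {L : ℝ≥0} (hh : IsLipschitzCutoff h L) {α : ℝ} (hα : 0 < α)
    {p : ℝ} (hp : 1 ≤ p) :
    (1 < p → ∀ pstar : ℝ, 1 / pstar = 1 / p - α / N → ∀ q : ℝ, p ≤ q → q ≤ pstar →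
      (potentialSpace μ N h α (ENNReal.ofReal p)).Embeds (lebesgueSpace μ (ENNReal.ofReal q))) ∧
    (p = N / α →
      (1 < p → ∀ q : ℝ, p ≤ q →
        (potentialSpace μ N h α (ENNReal.ofReal p)).Embeds
          (lebesgueSpace μ (ENNReal.ofReal q))) ∧
      (potentialSpace μ N h α (ENNReal.ofReal p)).Embeds (bmoSpace μ)) ∧
    (N / α < p →
      (∀ q : ℝ≥0∞, ENNReal.ofReal p ≤ q →
        (potentialSpace μ N h α (ENNReal.ofReal p)).Embeds (lebesgueSpace μ q)) ∧
      (α < 1 + N / p →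
        (potentialSpace μ N h α (ENNReal.ofReal p)).Embeds
          (holderSpace μ (α - N / p).toNNReal))) := by
  have hN := hreg.dim_pos
  have hp0 : 0 < p := by linarith
  obtain ⟨c, C, hc, hC⟩ := hreg.exists_growth hμ
  obtain ⟨K, s, hs, hspace⟩ := hh.exists_potentialSpace_eq_imageSpace hc hC
  simp only [hspace]
  refine ⟨fun hp1 pstar hpstar q hpq hq => ?_, fun hpN => ?_, fun hpN => ?_⟩
  · refine hs.imageSpace_embeds_lebesgueSpace hN hC hp1 hpq ?_
    have hexp : 1 / p - 1 / q ≤ α / N := by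
      linarith [one_div_le_one_div_of_le (hp0.trans_le hpq) hq]
    exact (mul_comm _ _).trans_le ((le_div_iff₀ hN).1 hexp)
  · have hαp : α = N / p := by rw [hpN, div_div_cancel₀ hN.ne']
    exact ⟨fun hp1 q hpq => hs.imageSpace_embeds_lebesgueSpace hN hC hp1 hpq
      (mul_one_div_sub_one_div_le hN (hp0.trans_le hpq) hαp.ge),
      hs.imageSpace_embeds_bmoSpace hN hc hC hp hαp⟩
  · have hαp : N / p < α := (div_lt_comm₀ hα hp0).1 hpN
    exact ⟨fun q hpq => hs.imageSpace_embeds_lebesgueSpace_of_lt hN hC hp hαp hpq,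
      hs.imageSpace_embeds_holderSpace hN hC hp hαp⟩

theorem mainTheorem6 {X : Type*} [MetricSpace X] [MeasurableSpace X] [OpensMeasurableSpace X]
    (μ : Measure X) (N : ℝ) (hreg : AhlforsBessel.IsAhlforsRegular μ N) (hμ : μ univ = ⊤)
    (h : ℝ → ℝ) (hh : AhlforsBessel.IsCutoff h)
    (α : ℝ) (hα : 0 < α) (p : ℝ) (hp : 1 < p) :
    (p < N / α → ∀ pstar : ℝ, 1 / pstar = 1 / p - α / N →
      ∀ q : ℝ, p ≤ q → q ≤ pstar →
        (AhlforsBessel.potentialSpace μ N h α (ENNReal.ofReal p)).Embeds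
          (AhlforsBessel.lebesgueSpace μ (ENNReal.ofReal q))) ∧
    (p = N / α →
      (∀ q : ℝ, p ≤ q →
        (AhlforsBessel.potentialSpace μ N h α (ENNReal.ofReal p)).Embeds
          (AhlforsBessel.lebesgueSpace μ (ENNReal.ofReal q))) ∧
      (α < 1 →
        (AhlforsBessel.potentialSpace μ N h α (ENNReal.ofReal p)).Embeds
          (AhlforsBessel.bmoSpace μ))) ∧
    (N / α < p →
      (∀ q : ℝ≥0∞, ENNReal.ofReal p ≤ q →
        (AhlforsBessel.potentialSpace μ N h α (ENNReal.ofReal p)).Embeds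
          (AhlforsBessel.lebesgueSpace μ q)) ∧
      (α < 1 + N / p →
        (AhlforsBessel.potentialSpace μ N h α (ENNReal.ofReal p)).Embeds
          (AhlforsBessel.holderSpace μ (α - N / p).toNNReal))) := by
  obtain ⟨L, hL⟩ := hh.exists_isLipschitzCutoff
  obtain ⟨subcritical, critical, supercritical⟩ := mainTheorem6_general hreg hμ hL hα hp.le
  exact ⟨fun _ => subcritical hp, fun hpN => (critical hpN).imp (· hp) fun hbmo _ => hbmo,
    supercritical⟩
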